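/- Work in $\mathsf{ZFC}$. For a cardinal $\theta$, $H_\theta$ is the set of all $x$ whose transitive closure has size less than $\theta$, and for a set $X$ we write $X \ll \theta$ (or $\theta \gg X$) if $\mathscr{P}(\mathscr{P}(X)) \in H_\theta$. We write $M \prec H_\theta$ if $(M,\in)$ is an elementary substructure of $(H_\theta,\in)$. For a countable $M \prec H_\theta$ with $\theta$ regular uncountable, and a set $x$, put $$\mathrm{Hull}(M,x) = \{ f(x) : f \in M \text{ a function},\ x \in \mathrm{dom}(f)\},$$ and write $x \parallel_{\omega_1} M$ if $\mathrm{Hull}(M,x) \cap \omega_1 = M \cap \omega_1$. For a set $X \in M$, the $X$-capturing game $\mathbf{G}^{cap}_M(X)$ is the following game of length $\omega$ of two players $P1$ and $P2$. Put $M_0 = M$. In round $n$, $P1$ plays some $x_n \in X$; then $P2$ has to play a function $f_n : \omega_1 \to X$ with $f_n(M_n \cap \omega_1) = x_n$ and $f_n \parallel_{\omega_1} M_n$; and $M_{n+1} = \mathrm{Hull}(M_n, f_n)$. If some player disobeys these rules, the player who first does so loses; otherwise $P2$ wins. $\mathrm{Glob}\text{-}\mathsf{SCC}^{\mathrm{cof}}$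 (Global Strong Chang's Conjecture) is the statement that for all regular cardinals $\theta \gg \lambda \geq \omega_2$, every countable $M \prec H_\theta$ with $\lambda \in M$, and every $X \in [H_\lambda]^{\omega_1}$ (that is, $X \subseteq H_\lambda$ with $|X| = \aleph_1$), there exists $Y \in [H_\lambda]^{\omega_1}$ such that $X \subseteq Y$ and $Y \parallel_{\omega_1} M$. **Proposition.** The following two statements are equivalent: (a) $\mathrm{Glob}\text{-}\mathsf{SCC}^{\mathrm{cof}}$; (b) for all regular cardinals $\theta \gg \lambda \geq \omega_2$ and every countable $M \prec H_\theta$ with $\lambda \in M$, $P2$ has a winning strategy in the $H_\lambda$-capturing game $\mathbf{G}^{cap}_M(H_\lambda)$ for $M$. -/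

import Mathlib

open FirstOrder Cardinal

universe u

namespace CapturingGame

/-! ### Transitive closures and the sets `H_θ` -/

/-- The transitive closure of `x`: the least transitive set that includes `x`. The ambient
`V_ (rank x)` only serves to make the intersection of all transitive supersets a set. -/
noncomputable def trcl (x : ZFSet.{u}) : ZFSet.{u} :=
  ZFSet.sep (fun y => ∀ t : ZFSet.{u}, t.IsTransitive → x ⊆ t → y ∈ t)
    (ZFSet.vonNeumann x.rank)

theorem mem_trcl {x y : ZFSet.{u}} :
    y ∈ trcl x ↔ ∀ t : ZFSet.{u}, t.IsTransitive → x ⊆ t → y ∈ t := by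
  rw [trcl, ZFSet.mem_sep]
  exact ⟨fun h => h.2, fun h =>
    ⟨h _ (ZFSet.isTransitive_vonNeumann _) (ZFSet.subset_vonNeumann_self x), h⟩⟩

theorem isTransitive_trcl (x : ZFSet.{u}) : (trcl x).IsTransitive := by
  intro y hy z hz
  rw [mem_trcl] at hy ⊢
  exact fun t ht hx => ht y (hy t ht hx) hz

theorem subset_trcl (x : ZFSet.{u}) : x ⊆ trcl x := fun _ hy =>
  mem_trcl.2 fun _ _ hx => hx hy

theorem exists_rank_eq {t : ZFSet.{u}} (ht : t.IsTransitive) (x : ZFSet.{u}) :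
    x ⊆ t → ∀ a < x.rank, ∃ y ∈ t, y.rank = a := by
  induction x using ZFSet.inductionOn with
  | _ x ih =>
    intro hx a ha
    obtain ⟨y, hy, hay⟩ := ZFSet.lt_rank_iff.1 ha
    rcases hay.eq_or_lt with h | h
    · exact ⟨y, hx hy, h.symm⟩
    · exact ih y hy (ht y (hx hy)) a h

theorem card_rank_le_card_trcl (x : ZFSet.{u}) : x.rank.card ≤ (trcl x).card := by
  rw [← Cardinal.lift_le.{u + 1}, ← ZFSet.cardinalMk_coe_sort, ← Cardinal.mk_Iio_ordinal]
  choose f hf hf' using exists_rank_eq (isTransitive_trcl x) x (subset_trcl x)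
  refine Cardinal.mk_le_of_injective
    (f := fun a : Set.Iio x.rank => (⟨f a.1 a.2, hf a.1 a.2⟩ : (trcl x : Type _))) ?_
  intro a b hab
  have h : f a.1 a.2 = f b.1 b.2 := congrArg Subtype.val hab
  exact Subtype.ext (by rw [← hf' a.1 a.2, ← hf' b.1 b.2, h])

/-- `H θ` is the set of all `x` whose transitive closure has fewer than `θ` elements; the
ambient `V_ θ` only serves to make this a set, see `mem_H`. -/
noncomputable def H (θ : Cardinal.{u}) : ZFSet.{u} :=
  ZFSet.sep (fun x => (trcl x).card < θ) (ZFSet.vonNeumann θ.ord)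

theorem mem_H {θ : Cardinal.{u}} {x : ZFSet.{u}} : x ∈ H θ ↔ (trcl x).card < θ := by
  rw [H, ZFSet.mem_sep, ZFSet.mem_vonNeumann, Cardinal.lt_ord]
  exact ⟨fun h => h.2, fun h => ⟨(card_rank_le_card_trcl x).trans_lt h, h⟩⟩

/-- A cardinal, regarded as a set (an initial von Neumann ordinal). -/
noncomputable def cardSet (κ : Cardinal.{u}) : ZFSet.{u} := κ.ord.toZFSet

/-- `ω₁` as a set. -/
noncomputable def omegaOne : ZFSet.{u} := cardSet (ℵ_ 1)

/-- `X ≪ θ`: the double power set of `X` belongs to `H θ`. -/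
def MuchSmaller (X : ZFSet.{u}) (θ : Cardinal.{u}) : Prop :=
  X.powerset.powerset ∈ H θ

/-! ### Elementary submodels -/

/-- The relation symbols of the language of set theory: one binary symbol. -/
inductive SetRel : ℕ → Type
  | mem : SetRel 2

/-- The first-order language `{∈}` of set theory. -/
def setLang : Language := ⟨fun _ => Empty, SetRel⟩

/-- Every collection of sets is a structure under the true membership relation. -/
instance memStructure (A : Set ZFSet.{u}) : setLang.Structure A where
  funMap f := f.elim
  RelMap
    | .mem => fun v => (v 0 : ZFSet.{u}) ∈ (v 1 : ZFSet.{u})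

/-- `M ≺ N` for the structures `(M, ∈)` and `(N, ∈)`: `M ⊆ N`, and the inclusion is
elementary. -/
def IsElementarySubmodel (M N : Set ZFSet.{u}) : Prop :=
  ∃ e : M ↪ₑ[setLang] N, ∀ x : M, (e x : ZFSet.{u}) = x

/-- `M` is a countable elementary submodel of `(H θ, ∈)`. -/
def IsCountableSubmodel (M : Set ZFSet.{u}) (θ : Cardinal.{u}) : Prop :=
  M.Countable ∧ IsElementarySubmodel M {x | x ∈ H θ}

/-! ### Hulls -/

/-- `Hull(M, x) = {f(x) : f ∈ M a function, x ∈ dom(f)}`. -/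
def hull (M : Set ZFSet.{u}) (x : ZFSet.{u}) : Set ZFSet.{u} :=
  {y | ∃ f ∈ M, (∃ d r, ZFSet.IsFunc d r f) ∧ ZFSet.pair x y ∈ f}

/-- `δ(M) = M ∩ ω₁`. -/
noncomputable def delta (M : Set ZFSet.{u}) : ZFSet.{u} :=
  ZFSet.sep (fun a => a ∈ M) omegaOne

/-- `x ∥_{ω₁} M`: adjoining `x` to `M` adds no new countable ordinals, that is,
`Hull(M, x) ∩ ω₁ = M ∩ ω₁`. -/
def Parallel (x : ZFSet.{u}) (M : Set ZFSet.{u}) : Prop :=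
  delta (hull M x) = delta M

/-! ### The capturing game -/

/-- The models `M₀ = M`, `Mₙ₊₁ = Hull(Mₙ, fₙ)` along a sequence `f` of moves of player two. -/
def model (M : Set ZFSet.{u}) (f : ℕ → ZFSet.{u}) : ℕ → Set ZFSet.{u}
  | 0 => M
  | n + 1 => hull (model M f n) (f n)

/-- Player two obeys the rules in a round with current model `N` and challenge `x`: the answer `g`
is a function `ω₁ → X` with `g(N ∩ ω₁) = x` and `g ∥_{ω₁} N`. -/
def LegalAnswer (X : ZFSet.{u}) (N : Set ZFSet.{u}) (x g : ZFSet.{u}) : Prop :=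
  ZFSet.IsFunc omegaOne X g ∧ ZFSet.pair (delta N) x ∈ g ∧ Parallel g N

/-- Player two wins the run in which player one plays `x 0, x 1, …` (each `x n` has to lie in `X`)
and player two answers `f 0, f 1, …`: in no round is player two the first to disobey the rules.
In each round player one moves first. -/
def P2WinsRun (M : Set ZFSet.{u}) (X : ZFSet.{u}) (x f : ℕ → ZFSet.{u}) : Prop :=
  ∀ n, ¬ LegalAnswer X (model M f n) (x n) (f n) → ∃ k ≤ n, x k ∉ X

/-- A strategy for player two: from the list of all previous rounds (move of player one, answer of
player two) and the current move of player one it computes the current answer. -/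
abbrev Strategy : Type (u + 1) := List (ZFSet.{u} × ZFSet.{u}) → ZFSet.{u} → ZFSet.{u}

/-- In the run `(x, f)` player two follows the strategy `σ`. -/
def Follows (σ : Strategy.{u}) (x f : ℕ → ZFSet.{u}) : Prop :=
  ∀ n, f n = σ (List.ofFn fun i : Fin n => (x i, f i)) (x n)

/-- Player two has a winning strategy in the `X`-capturing game for `M`. -/
def P2HasWinningStrategy (M : Set ZFSet.{u}) (X : ZFSet.{u}) : Prop :=
  ∃ σ : Strategy.{u}, ∀ x f : ℕ → ZFSet.{u}, Follows σ x f → P2WinsRun M X x f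

/-! ### Global Strong Chang's Conjecture -/

/-- `Glob-SCC^cof`: for all regular `θ ≫ λ ≥ ω₂`, every countable `M ≺ H_θ` with `λ ∈ M` and every
`X ∈ [H_λ]^{ω₁}` there is `Y ∈ [H_λ]^{ω₁}` with `X ⊆ Y` and `Y ∥_{ω₁} M`. -/
def GlobSCCcof : Prop :=
  ∀ θ l : Cardinal.{u}, θ.IsRegular → l.IsRegular → ℵ_ 2 ≤ l → MuchSmaller (cardSet l) θ →
    ∀ M : Set ZFSet.{u}, IsCountableSubmodel M θ → cardSet l ∈ M →
      ∀ X : ZFSet.{u}, X ⊆ H l → X.card = ℵ_ 1 →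
        ∃ Y : ZFSet.{u}, Y ⊆ H l ∧ Y.card = ℵ_ 1 ∧ X ⊆ Y ∧ Parallel Y M

end CapturingGame

/-!
A winning strategy of player two yields `Glob-SCC^cof` by looking at one round: given `X`, let
player one play `X` itself, which is an element of `H λ`. If `f` is the answer, then the union `Y`
of all `f(α)` of size at most `ℵ₁` is definable from `f`, so it lies in `Hull(M, f)`, and it
includes `f(δ) = X` (`exists_parallel_superset`).

Conversely, hulls of countable elementary submodels by elements of `H λ` are again countable
elementary submodels (`hull_submodel`), so player two only has to survive a single round: given `x
∈ H λ` and `δ = M ∩ ω₁`, an extension of `M` with the same countable ordinals has to contain a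
function `f` on `ω₁` with `f(δ) = x`. By `Glob-SCC^cof` some extension contains an enumeration `e`
on `ω₁` with `x = e(α)` for some `α < ω₁`, which reduces the problem to finding, in a further
extension, a function with value `α` at `δ`. That every `α < ω₁` is reachable in this sense is
shown by induction (`SCCcof.reachable`). Let `fₙ` be functions, in the union of a chain of
extensions, whose values at `δ` exhaust `α`. By `Glob-SCC^cof` some extension `N` contains an
enumeration `e` on `ω₁` whose range contains all `fₙ`. Since `fₙ ∈ N`, the index of `fₙ` can be
taken in `N ∩ ω₁ = δ`; hence the countable set of all `e(ξ)(δ)` with `ξ < δ`, which lies in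
`Hull(N, δ)`, includes `α` (`SCCcof.exists_bound`). So `Hull(N, δ)` contains a countable ordinal
that is at least `α`, and therefore `α` itself, which means that `α` is the value at `δ` of a
function in `N`.

Elementarity is used in the form that `M` meets every nonempty set definable with parameters from
`M` (`Submodel.exists_mem`); the class `Dfn` records definability.
-/

namespace CapturingGame

/-! ### Elementary submodels and definable sets -/

/-- `K` is transitive and `M ⊆ K` meets every nonempty subset of `K` that is definable over `(K, ∈)`
with parameters from `M`. By the Tarski–Vaught test the latter says `M ≺ K`. -/
class Submodel (K M : Set ZFSet.{u}) : Prop where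
  subset : M ⊆ K
  trans : ∀ {x y : ZFSet.{u}}, x ∈ y → y ∈ K → x ∈ K
  meets : setLang.MeetsDefinable {x : K | x.1 ∈ M}

theorem meetsDefinable_of_elementary {K M : Set ZFSet.{u}} (h : IsElementarySubmodel M K) :
    M ⊆ K ∧ setLang.MeetsDefinable {x : K | x.1 ∈ M} := by
  obtain ⟨e, he⟩ := h
  have hMK : M ⊆ K := fun x hx => by
    have := (e ⟨x, hx⟩).2
    rwa [he] at this
  refine ⟨hMK, ?_⟩
  rintro D ⟨x, hx⟩ hD
  obtain ⟨φ, hφ⟩ := Set.definable_iff_exists_formula_sum.1 hD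
  let j : {x : K | x.1 ∈ M} → M := fun a => ⟨a.1.1, a.2⟩
  have hj : e ∘ j = Subtype.val := by
    funext a
    exact Subtype.ext (he _)
  have hx' : (φ.iExs (Fin 1)).Realize (Subtype.val : {x : K | x.1 ∈ M} → K) := by
    rw [Language.Formula.realize_iExs]
    refine ⟨fun _ => x, ?_⟩
    have : (fun _ => x) ∈ {x : Fin 1 → K | x 0 ∈ D} := hx
    rwa [hφ] at this
  rw [← hj, e.map_formula, Language.Formula.realize_iExs] at hx'
  obtain ⟨i, hi⟩ := hx'
  rw [← e.map_formula, Sum.comp_elim, hj] at hi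
  have : e ∘ i ∈ {x : Fin 1 → K | x 0 ∈ D} := by rw [hφ]; exact hi
  refine ⟨e (i 0), this, ?_⟩
  simp [he]

theorem elementary_of_meetsDefinable {K M : Set ZFSet.{u}} (hMK : M ⊆ K)
    (h : setLang.MeetsDefinable {x : K | x.1 ∈ M}) : IsElementarySubmodel M K := by
  let f : M ↪[setLang] K :=
    { toFun := fun x => ⟨x.1, hMK x.2⟩
      inj' := fun a b hab => Subtype.ext (congrArg (fun z : K => z.1) hab)
      map_fun' := fun f => f.elim
      map_rel' := fun r v => by cases r; rfl }
  refine ⟨f.toElementaryEmbedding ?_, fun _ => rfl⟩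
  intro n φ x a hφ
  obtain ⟨b, hb, hbM⟩ := h {y | φ.Realize default (Fin.snoc (f ∘ x) y : _ → K)} ⟨a, hφ⟩ (by
    refine Set.definable_iff_exists_formula_sum.2 ⟨φ.toFormula.relabel (Sum.elim Empty.elim
      (Fin.lastCases (Sum.inr 0) fun i => Sum.inl ⟨f (x i), (x i).2⟩)), ?_⟩
    ext v
    rw [Set.mem_ofPred_eq, Set.mem_ofPred_eq, Set.mem_ofPred_eq, Language.Formula.realize_relabel,
      Language.BoundedFormula.realize_toFormula, iff_iff_eq]
    congr 1
    · exact Subsingleton.elim _ _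
    · funext i
      cases i using Fin.lastCases <;> simp)
  exact ⟨⟨b.1, hbM⟩, hb⟩

/-- The membership symbol, as a relation symbol of `setLang`. -/
def memRel : setLang.Relations 2 := SetRel.mem

/-- The predicate `P` of `α`-indexed tuples from `K` is definable over `(K, ∈)` with parameters from
`M`. This is a class so that instance search can assemble the defining formulas. Under a quantifier
the index type `α` becomes `α ⊕ Unit`, the summand `Unit` standing for the bound variable;
parameters are announced by instances of `Fact (m ∈ M)`. -/
class Dfn (K M : Set ZFSet.{u}) {α : Type*} (P : (α → K) → Prop) : Prop where
  out : ({x : K | x.1 ∈ M}).Definable setLang {v | P v}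

/-- The function `t` of tuples from `K` is given by a term of the language with parameters from `M`.
As there are no function symbols, `t` is a coordinate or a constant from `M`. -/
class Tm (K M : Set ZFSet.{u}) {α : Type*} (t : (α → K) → ZFSet.{u}) : Prop where
  out : ∃ s : setLang.Term ({x : K | x.1 ∈ M} ⊕ α), ∀ v, t v = s.realize (Sum.elim (↑) v)

section Definability

variable {K M : Set ZFSet.{u}} {α : Type*}

instance Tm.var (i : α) : Tm K M (fun v : α → K => v i) :=
  ⟨.var (.inr i), fun _ => rfl⟩

instance Tm.const [Submodel K M] (m : ZFSet.{u}) [hm : Fact (m ∈ M)] :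
    Tm K M (fun _ : α → K => m) :=
  ⟨.var (.inl ⟨⟨m, Submodel.subset hm.out⟩, hm.out⟩), fun _ => rfl⟩

namespace Dfn

theorem congr {P Q : (α → K) → Prop} (h : ∀ v, P v ↔ Q v) [hQ : Dfn K M Q] : Dfn K M P := by
  have : P = Q := funext fun v => propext (h v)
  rwa [this]

variable {P Q : (α → K) → Prop} {s t r : (α → K) → ZFSet.{u}}

instance mem [hs : Tm K M s] [ht : Tm K M t] : Dfn K M (fun v => s v ∈ t v) := by
  obtain ⟨a, ha⟩ := hs.out
  obtain ⟨b, hb⟩ := ht.out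
  refine ⟨Set.definable_iff_exists_formula_sum.2
    ⟨memRel.formula₂ a b, ?_⟩⟩
  ext v
  rw [Set.mem_ofPred_eq, Set.mem_ofPred_eq, Language.Formula.realize_rel₂, ha, hb]
  rfl

instance eq [hs : Tm K M s] [ht : Tm K M t] : Dfn K M (fun v => s v = t v) := by
  obtain ⟨a, ha⟩ := hs.out
  obtain ⟨b, hb⟩ := ht.out
  refine ⟨Set.definable_iff_exists_formula_sum.2 ⟨a.equal b, ?_⟩⟩
  ext v
  rw [Set.mem_ofPred_eq, Set.mem_ofPred_eq, Language.Formula.realize_equal, ha, hb]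
  exact Subtype.ext_iff.symm

instance and [hP : Dfn K M P] [hQ : Dfn K M Q] : Dfn K M (fun v => P v ∧ Q v) :=
  ⟨hP.out.inter hQ.out⟩

instance or [hP : Dfn K M P] [hQ : Dfn K M Q] : Dfn K M (fun v => P v ∨ Q v) :=
  ⟨hP.out.union hQ.out⟩

instance not [hP : Dfn K M P] : Dfn K M (fun v => ¬ P v) := ⟨hP.out.compl⟩

instance imp [hP : Dfn K M P] [hQ : Dfn K M Q] : Dfn K M (fun v => P v → Q v) :=
  congr (fun _ => imp_iff_not_or)

instance iff [hP : Dfn K M P] [hQ : Dfn K M Q] : Dfn K M (fun v => P v ↔ Q v) :=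
  congr (fun _ => iff_def)

theorem comp {β : Type*} (f : α → β) [hP : Dfn K M P] : Dfn K M (fun w : β → K => P (w ∘ f)) :=
  ⟨hP.out.preimage_comp f⟩

instance all_fin {ι : Type*} [Finite ι] {R : ι → (α → K) → Prop} [h : ∀ i, Dfn K M (R i)] :
    Dfn K M (fun v => ∀ i, R i v) := by
  have := Set.definable_iInter_of_finite (fun i => (h i).out)
  refine ⟨?_⟩
  convert this using 1
  ext v; simp

theorem ex_tuple {ι : Type*} [Finite ι] {R : (α → K) → (ι → K) → Prop}
    [h : Dfn K M (fun w : α ⊕ ι → K => R (fun i => w (.inl i)) (fun i => w (.inr i)))] :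
    Dfn K M (fun v => ∃ u : ι → K, R v u) := by
  obtain ⟨φ, hφ⟩ := Set.definable_iff_exists_formula_sum.1 h.out
  refine ⟨Set.definable_iff_exists_formula_sum.2
    ⟨(φ.relabel (Equiv.sumAssoc _ _ _).symm).iExs ι, ?_⟩⟩
  ext v
  rw [Set.mem_ofPred_eq, Set.mem_ofPred_eq, Language.Formula.realize_iExs]
  refine exists_congr fun u => ?_
  rw [Language.Formula.realize_relabel]
  have := congrArg (fun S => Sum.elim v u ∈ S) hφ
  simp only [Set.mem_ofPred_eq, Sum.elim_inl, Sum.elim_inr, eq_iff_iff] at this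
  rw [this, iff_iff_eq]
  congr 1
  funext i
  rcases i with i | i | i <;> rfl

instance ex {R : (α → K) → ZFSet.{u} → Prop}
    [h : Dfn K M (fun w : α ⊕ Unit → K => R (fun i => w (.inl i)) (w (.inr ())))] :
    Dfn K M (fun v => ∃ a ∈ K, R v a) :=
  have := ex_tuple (R := fun v (u : Unit → K) => R v (u ())) (h := h)
  congr (Q := fun v => ∃ u : Unit → K, R v (u ())) (fun _ =>
    ⟨fun ⟨a, ha, h⟩ => ⟨fun _ => ⟨a, ha⟩, h⟩, fun ⟨w, h⟩ => ⟨_, (w ()).2, h⟩⟩)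

instance all {R : (α → K) → ZFSet.{u} → Prop}
    [h : Dfn K M (fun w : α ⊕ Unit → K => R (fun i => w (.inl i)) (w (.inr ())))] :
    Dfn K M (fun v => ∀ a ∈ K, R v a) :=
  congr (Q := fun v => ¬ ∃ a ∈ K, ¬ R v a) (fun v => by push Not; rfl)

theorem _root_.CapturingGame.Tm.mem_K [ht : Tm K M t] (v : α → K) : t v ∈ K := by
  obtain ⟨s, hs⟩ := ht
  rw [hs]
  exact Subtype.coe_prop _

/-- Weakening of a term by a further variable. -/
theorem _root_.CapturingGame.Tm.inl [ht : Tm K M t] :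
    Tm K M (fun w : α ⊕ Unit → K => t (fun i => w (.inl i))) := by
  obtain ⟨s, hs⟩ := ht
  refine ⟨s.relabel (Sum.map id .inl), fun v => ?_⟩
  rw [hs, Language.Term.realize_relabel]
  congr 2
  funext i
  rcases i with i | i <;> rfl

variable [Submodel K M]

instance bex {R : (α → K) → ZFSet.{u} → Prop} [ht : Tm K M t]
    [h : Dfn K M (fun w : α ⊕ Unit → K => R (fun i => w (.inl i)) (w (.inr ())))] :
    Dfn K M (fun v => ∃ a ∈ t v, R v a) :=
  have := Tm.inl (t := t) (K := K) (M := M)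
  congr (Q := fun v => ∃ a ∈ K, a ∈ t v ∧ R v a) (fun v =>
    ⟨fun ⟨a, ha, h⟩ => ⟨a, Submodel.trans M ha (Tm.mem_K (M := M) v), ha, h⟩,
      fun ⟨a, _, h⟩ => ⟨a, h⟩⟩)

instance ball {R : (α → K) → ZFSet.{u} → Prop} [ht : Tm K M t]
    [h : Dfn K M (fun w : α ⊕ Unit → K => R (fun i => w (.inl i)) (w (.inr ())))] :
    Dfn K M (fun v => ∀ a ∈ t v, R v a) :=
  congr (Q := fun v => ¬ ∃ a ∈ t v, ¬ R v a) (fun v => by push Not; rfl)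

instance subset [Tm K M s] [Tm K M t] : Dfn K M (fun v => s v ⊆ t v) :=
  have := Tm.inl (t := t) (K := K) (M := M)
  congr (Q := fun v => ∀ a ∈ s v, a ∈ t v) (fun _ => Iff.rfl)

instance eq_upair [Tm K M s] [Tm K M t] [Tm K M r] : Dfn K M (fun v => r v = {s v, t v}) :=
  have := Tm.inl (t := t) (K := K) (M := M)
  have := Tm.inl (t := s) (K := K) (M := M)
  congr (Q := fun v => s v ∈ r v ∧ t v ∈ r v ∧ ∀ a ∈ r v, a = s v ∨ a = t v) (fun v => by
    constructor
    · intro h; simp [h]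
    · rintro ⟨h1, h2, h3⟩
      ext z
      rw [ZFSet.mem_pair]
      exact ⟨h3 z, by rintro (rfl | rfl) <;> assumption⟩)

instance eq_pair [Tm K M s] [Tm K M t] [Tm K M r] :
    Dfn K M (fun v => r v = ZFSet.pair (s v) (t v)) :=
  have := Tm.inl (t := t) (K := K) (M := M)
  have := Tm.inl (t := s) (K := K) (M := M)
  congr (Q := fun v => (∃ a ∈ r v, a = {s v, s v}) ∧ (∃ a ∈ r v, a = {s v, t v}) ∧
      ∀ a ∈ r v, a = {s v, s v} ∨ a = {s v, t v}) (fun v => by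
    constructor
    · intro h; simp [h, ZFSet.pair]
    · rintro ⟨⟨_, h1, rfl⟩, ⟨_, h2, rfl⟩, h3⟩
      ext z
      rw [ZFSet.pair, ZFSet.mem_pair, ← ZFSet.pair_eq_singleton (s v)]
      exact ⟨h3 z, by rintro (rfl | rfl) <;> assumption⟩)

instance pair_mem [Tm K M s] [Tm K M t] [Tm K M r] :
    Dfn K M (fun v => ZFSet.pair (s v) (t v) ∈ r v) :=
  have := Tm.inl (t := t) (K := K) (M := M)
  have := Tm.inl (t := s) (K := K) (M := M)
  congr (Q := fun v => ∃ p ∈ r v, p = ZFSet.pair (s v) (t v)) (fun v => by simp)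

end Dfn

/-- A nonempty class that is definable over `K` with parameters from `M` has an element in `M`. -/
theorem Submodel.exists_mem [hM : Submodel K M] {P : ZFSet.{u} → Prop} {a : ZFSet.{u}}
    (ha : a ∈ K) (hP : P a)
    [h : Dfn K M (fun v : Unit → K => P (v ()))] : ∃ a ∈ M, P a := by
  obtain ⟨b, hb, hbM⟩ := hM.meets {a | P a} ⟨⟨a, ha⟩, hP⟩ (by
    have := h.out.preimage_comp (fun _ : Unit => (0 : Fin 1))
    exact this)
  exact ⟨b, hbM, hb⟩

end Definability

/-! ### Closure properties of `H θ` -/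

theorem trcl_subset {x t : ZFSet.{u}} (ht : t.IsTransitive) (hx : x ⊆ t) : trcl x ⊆ t :=
  fun _ hy => mem_trcl.1 hy t ht hx

theorem trcl_eq_self {x : ZFSet.{u}} (hx : x.IsTransitive) : trcl x = x :=
  le_antisymm (trcl_subset hx (fun _ h => h)) (subset_trcl x)

theorem card_le_card_trcl (x : ZFSet.{u}) : x.card ≤ (trcl x).card :=
  ZFSet.card_mono (subset_trcl x)

section
variable {θ : Cardinal.{u}} {x y : ZFSet.{u}}

theorem H_mem_trans (hxy : x ∈ y) (hy : y ∈ H θ) : x ∈ H θ := by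
  rw [mem_H] at hy ⊢
  refine (ZFSet.card_mono (trcl_subset (isTransitive_trcl y) ?_)).trans_lt hy
  exact isTransitive_trcl y _ (subset_trcl y hxy)

theorem H_subset_mem (hxy : x ⊆ y) (hy : y ∈ H θ) : x ∈ H θ := by
  rw [mem_H] at hy ⊢
  exact (ZFSet.card_mono (trcl_subset (isTransitive_trcl y)
    (fun _ h => subset_trcl y (hxy h)))).trans_lt hy

theorem H_mono {κ : Cardinal.{u}} (h : κ ≤ θ) (hx : x ∈ H κ) : x ∈ H θ :=
  mem_H.2 ((mem_H.1 hx).trans_le h)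

theorem card_lt_of_mem_H (hx : x ∈ H θ) : x.card < θ :=
  (card_le_card_trcl x).trans_lt (mem_H.1 hx)

/-- For regular `θ`, every subset of `H θ` with fewer than `θ` elements belongs to `H θ`. -/
theorem mem_H_of_subset (hθ : θ.IsRegular) (hx : x ⊆ H θ) (hc : x.card < θ) : x ∈ H θ := by
  rw [mem_H]
  let t : Shrink.{u} x → ZFSet.{u} := fun z => trcl ((equivShrink x).symm z).1
  have hsub : trcl x ⊆ x ∪ ZFSet.iUnion t := by
    refine trcl_subset ?_ (fun z hz => ZFSet.mem_union.2 (Or.inl hz))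
    have key : ∀ y ∈ x, trcl y ⊆ x ∪ ZFSet.iUnion t := fun y hy z hz =>
      ZFSet.mem_union.2 (Or.inr (ZFSet.mem_iUnion.2 ⟨equivShrink x ⟨y, hy⟩, by simpa [t] using hz⟩))
    intro y hy z hz
    rcases ZFSet.mem_union.1 hy with hy | hy
    · exact key y hy (subset_trcl y hz)
    · obtain ⟨i, hi⟩ := ZFSet.mem_iUnion.1 hy
      exact key _ ((equivShrink x).symm i).2 (isTransitive_trcl _ _ hi hz)
  refine (ZFSet.card_mono hsub).trans_lt (ZFSet.card_union_le.trans_lt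
    (add_lt_of_lt hθ.aleph0_le hc ?_))
  have h := ZFSet.lift_card_iUnion_le_sum_card (f := t)
  rw [lift_id] at h
  exact h.trans_lt (sum_lt_of_isRegular hθ hc
    fun i => mem_H.1 (hx ((equivShrink x).symm i).2))

theorem pair_mem_H (hθ : θ.IsRegular) (hx : x ∈ H θ) (hy : y ∈ H θ) : ZFSet.pair x y ∈ H θ := by
  have h2 : ∀ a b : ZFSet.{u}, a ∈ H θ → b ∈ H θ → ({a, b} : ZFSet.{u}) ∈ H θ := fun a b ha hb => by
    refine mem_H_of_subset hθ ?_ ?_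
    · intro z hz
      rcases ZFSet.mem_pair.1 hz with rfl | rfl <;> assumption
    · refine ZFSet.card_insert_le.trans_lt ?_
      rw [ZFSet.card_singleton, one_add_one_eq_two]
      exact_mod_cast hθ.nat_lt 2
  rw [ZFSet.pair, ← ZFSet.pair_eq_singleton x]
  exact h2 _ _ (h2 _ _ hx hx) (h2 _ _ hx hy)

theorem mem_sUnion_sUnion_of_pair_mem {f : ZFSet.{u}} (h : ZFSet.pair x y ∈ f) :
    x ∈ (ZFSet.sUnion (ZFSet.sUnion f)) ∧ y ∈ (ZFSet.sUnion (ZFSet.sUnion f)) := by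
  have : ({x, y} : ZFSet.{u}) ∈ ZFSet.sUnion f := ZFSet.mem_sUnion.2 ⟨_, h, by simp [ZFSet.pair]⟩
  exact ⟨ZFSet.mem_sUnion.2 ⟨_, this, by simp⟩, ZFSet.mem_sUnion.2 ⟨_, this, by simp⟩⟩

end

/-- A transitive class contains the components of the pairs in it. -/
theorem pair_mem_trans {A : Set ZFSet.{u}} (hA : ∀ {x y : ZFSet.{u}}, x ∈ y → y ∈ A → x ∈ A)
    {x y : ZFSet.{u}} (h : ZFSet.pair x y ∈ A) : x ∈ A ∧ y ∈ A := by
  have h' : ({x, y} : ZFSet.{u}) ∈ A := hA (by simp [ZFSet.pair]) h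
  exact ⟨hA (by simp) h', hA (by simp) h'⟩

/-! ### Functions as sets -/

/-- `f` is a function: a set of ordered pairs that is single-valued. -/
def IsFn (f : ZFSet.{u}) : Prop :=
  (∀ p ∈ f, ∃ a b, p = ZFSet.pair a b) ∧
    ∀ a b c, ZFSet.pair a b ∈ f → ZFSet.pair a c ∈ f → b = c

theorem isFn_iff {f : ZFSet.{u}} : IsFn f ↔ ∃ d r, ZFSet.IsFunc d r f := by
  constructor
  · rintro ⟨h1, h2⟩
    refine ⟨ZFSet.sep (fun a => ∃ b, ZFSet.pair a b ∈ f) (ZFSet.sUnion (ZFSet.sUnion f)),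
      ZFSet.sUnion (ZFSet.sUnion f), fun p hp => ?_, fun a ha => ?_⟩
    · obtain ⟨a, b, rfl⟩ := h1 p hp
      have := mem_sUnion_sUnion_of_pair_mem hp
      exact ZFSet.mem_prod.2 ⟨a, ZFSet.mem_sep.2 ⟨this.1, b, hp⟩, b, this.2, rfl⟩
    · obtain ⟨b, hb⟩ := (ZFSet.mem_sep.1 ha).2
      exact ⟨b, hb, fun c hc => h2 _ _ _ hc hb⟩
  · rintro ⟨d, r, h1, h2⟩
    refine ⟨fun p hp => ?_, fun a b c hb hc => ?_⟩
    · obtain ⟨a, -, b, -, h⟩ := ZFSet.mem_prod.1 (h1 hp)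
      exact ⟨a, b, h⟩
    · exact (h2 a (ZFSet.pair_mem_prod.1 (h1 hb)).1).unique hb hc

theorem IsFn.subset {f g : ZFSet.{u}} (hf : IsFn f) (h : g ⊆ f) : IsFn g :=
  ⟨fun p hp => hf.1 p (h hp), fun a b c hb hc => hf.2 a b c (h hb) (h hc)⟩

theorem isFunc_iff {d r f : ZFSet.{u}} : ZFSet.IsFunc d r f ↔
    IsFn f ∧ (∀ a ∈ d, ∃ b, ZFSet.pair a b ∈ f) ∧ ∀ a b, ZFSet.pair a b ∈ f → a ∈ d ∧ b ∈ r := by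
  constructor
  · intro h
    exact ⟨isFn_iff.2 ⟨d, r, h⟩, fun a ha => (h.2 a ha).exists,
      fun a b hab => ZFSet.pair_mem_prod.1 (h.1 hab)⟩
  · rintro ⟨h1, h2, h3⟩
    refine ⟨fun p hp => ?_, fun a ha => ?_⟩
    · obtain ⟨a, b, rfl⟩ := h1.1 p hp
      exact ZFSet.pair_mem_prod.2 (h3 a b hp)
    · obtain ⟨b, hb⟩ := h2 a ha
      exact ⟨b, hb, fun c hc => h1.2 _ _ _ hc hb⟩

theorem mem_hull {M : Set ZFSet.{u}} {x y : ZFSet.{u}} :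
    y ∈ hull M x ↔ ∃ f ∈ M, IsFn f ∧ ZFSet.pair x y ∈ f := by
  simp only [hull, isFn_iff]; rfl

instance Dfn.isFn {K M : Set ZFSet.{u}} {α : Type*} {t : (α → K) → ZFSet.{u}} [hM : Submodel K M]
    [Tm K M t] : Dfn K M (fun v => IsFn (t v)) := by
  have i1 := Tm.inl (t := t) (K := K) (M := M)
  have i2 := Tm.inl (t := fun w : α ⊕ Unit → K => t (fun i => w (.inl i))) (K := K) (M := M)
  have i3 := Tm.inl (t := fun w : (α ⊕ Unit) ⊕ Unit → K => t (fun i => w (.inl (.inl i))))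
    (K := K) (M := M)
  refine congr (Q := fun v => (∀ p ∈ t v, ∃ a ∈ K, ∃ b ∈ K, p = ZFSet.pair a b) ∧
    ∀ a ∈ K, ∀ b ∈ K, ∀ c ∈ K, ZFSet.pair a b ∈ t v → ZFSet.pair a c ∈ t v → b = c) (fun v => ?_)
  have ht : ∀ {p}, p ∈ t v → p ∈ K := fun hp => hM.trans hp (Tm.mem_K (M := M) v)
  refine and_congr (forall₂_congr fun p hp => ?_) ?_
  · constructor
    · rintro ⟨a, b, rfl⟩
      have := pair_mem_trans hM.trans (ht hp)
      exact ⟨a, this.1, b, this.2, rfl⟩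
    · rintro ⟨a, -, b, -, h⟩
      exact ⟨a, b, h⟩
  · refine ⟨fun h a _ b _ c _ => h a b c, fun h a b c hb hc => ?_⟩
    have hab := pair_mem_trans hM.trans (ht hb)
    exact h a hab.1 b hab.2 c (pair_mem_trans hM.trans (ht hc)).2 hb hc

/-- The image of a set under an arbitrary function, definable or not. -/
noncomputable def img (F : ZFSet.{u} → ZFSet.{u}) (x : ZFSet.{u}) : ZFSet.{u} :=
  @ZFSet.image F (Classical.allZFSetDefinable _) x

theorem mem_img {F : ZFSet.{u} → ZFSet.{u}} {x y : ZFSet.{u}} : y ∈ img F x ↔ ∃ z ∈ x, F z = y :=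
  letI := @Classical.allZFSetDefinable; ZFSet.mem_image

theorem card_img_le {F : ZFSet.{u} → ZFSet.{u}} {x : ZFSet.{u}} : (img F x).card ≤ x.card :=
  letI := @Classical.allZFSetDefinable; ZFSet.card_image_le

/-- `H θ` contains the graph of every function from one of its elements into it. -/
theorem graph_mem_H {θ : Cardinal.{u}} (hθ : θ.IsRegular) {D : ZFSet.{u}} (hD : D ∈ H θ)
    {F : ZFSet.{u} → ZFSet.{u}} (hF : ∀ z ∈ D, F z ∈ H θ) :
    img (fun z => ZFSet.pair z (F z)) D ∈ H θ := by
  refine mem_H_of_subset hθ (fun p hp => ?_) (card_img_le.trans_lt (card_lt_of_mem_H hD))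
  obtain ⟨z, hz, rfl⟩ := mem_img.1 hp
  exact pair_mem_H hθ (H_mem_trans hz hD) (hF z hz)

theorem pair_mem_graph {D a b : ZFSet.{u}} {F : ZFSet.{u} → ZFSet.{u}} :
    ZFSet.pair a b ∈ img (fun z => ZFSet.pair z (F z)) D ↔ a ∈ D ∧ F a = b := by
  rw [mem_img]
  constructor
  · rintro ⟨z, hz, h⟩
    obtain ⟨rfl, rfl⟩ := ZFSet.pair_inj.1 h
    exact ⟨hz, rfl⟩
  · rintro ⟨ha, rfl⟩
    exact ⟨a, ha, rfl⟩

theorem isFn_graph (D : ZFSet.{u}) (F : ZFSet.{u} → ZFSet.{u}) :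
    IsFn (img (fun z => ZFSet.pair z (F z)) D) := by
  refine ⟨fun p hp => ?_, fun a b c hb hc => ?_⟩
  · obtain ⟨z, -, rfl⟩ := mem_img.1 hp
    exact ⟨_, _, rfl⟩
  · rw [pair_mem_graph] at hb hc
    rw [← hb.2, hc.2]

/-- The function `f` maps a subset of `d` onto a superset of `y`. The domain of `f` is not
required to be included in `d`. -/
def Covers (f d y : ZFSet.{u}) : Prop :=
  IsFn f ∧ ∀ b ∈ y, ∃ a ∈ d, ZFSet.pair a b ∈ f

theorem Covers.card_le {f d y : ZFSet.{u}} (h : Covers f d y) : y.card ≤ d.card := by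
  choose! g hg hg' using h.2
  rw [← Cardinal.lift_le.{u + 1}, ← ZFSet.cardinalMk_coe_sort, ← ZFSet.cardinalMk_coe_sort]
  refine Cardinal.mk_le_of_injective (f := fun b : y => (⟨g b.1, hg _ b.2⟩ : d)) ?_
  intro b c hbc
  have hbc : g b.1 = g c.1 := congrArg Subtype.val hbc
  have := hg' _ b.2
  rw [hbc] at this
  exact Subtype.ext (h.1.2 _ _ _ this (hg' _ c.2))

open Classical in
theorem exists_covers {θ : Cardinal.{u}} (hθ : θ.IsRegular) {d y : ZFSet.{u}} (hd : d ∈ H θ)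
    (hy : y ∈ H θ) (h : y.card ≤ d.card) : ∃ f ∈ H θ, Covers f d y := by
  rw [← Cardinal.lift_le.{u + 1}, ← ZFSet.cardinalMk_coe_sort, ← ZFSet.cardinalMk_coe_sort] at h
  obtain ⟨i⟩ := h
  let F : ZFSet.{u} → ZFSet.{u} := fun b => if hb : b ∈ y then (i ⟨b, hb⟩).1 else ∅
  have hF : ∀ b (hb : b ∈ y), F b = (i ⟨b, hb⟩).1 := fun b hb => dif_pos hb
  have hFd : ∀ b ∈ y, F b ∈ d := fun b hb => by rw [hF b hb]; exact (i _).2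
  refine ⟨img (fun b => ZFSet.pair (F b) b) y, ?_, ⟨?_, ?_⟩, ?_⟩
  · refine mem_H_of_subset hθ (fun p hp => ?_) (card_img_le.trans_lt (card_lt_of_mem_H hy))
    obtain ⟨z, hz, rfl⟩ := mem_img.1 hp
    exact pair_mem_H hθ (H_mem_trans (hFd z hz) hd) (H_mem_trans hz hy)
  · intro p hp
    obtain ⟨z, -, rfl⟩ := mem_img.1 hp
    exact ⟨_, _, rfl⟩
  · intro a b c hb hc
    obtain ⟨b', hb', h1⟩ := mem_img.1 hb
    obtain ⟨c', hc', h2⟩ := mem_img.1 hc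
    obtain ⟨ha, rfl⟩ := ZFSet.pair_inj.1 h1
    obtain ⟨ha', rfl⟩ := ZFSet.pair_inj.1 h2
    have h := ha.trans ha'.symm
    rw [hF _ hb', hF _ hc'] at h
    exact congrArg Subtype.val (i.injective (Subtype.ext h))
  · exact fun b hb => ⟨F b, hFd b hb, mem_img.2 ⟨b, hb, rfl⟩⟩

instance Dfn.covers {K M : Set ZFSet.{u}} {α : Type*} {f d y : (α → K) → ZFSet.{u}}
    [Submodel K M] [Tm K M f] [Tm K M d] [Tm K M y] :
    Dfn K M (fun v => Covers (f v) (d v) (y v)) :=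
  have := Tm.inl (t := f) (K := K) (M := M)
  have := Tm.inl (t := d) (K := K) (M := M)
  have := Tm.inl (t := fun w : α ⊕ Unit → K => f (fun i => w (.inl i))) (K := K) (M := M)
  congr (Q := fun v => IsFn (f v) ∧ ∀ b ∈ y v, ∃ a ∈ d v, ZFSet.pair a b ∈ f v)
    (fun _ => Iff.rfl)

/-! ### Hulls -/

/-- The class of all elements of `H θ`. -/
abbrev HC (θ : Cardinal.{u}) : Set ZFSet.{u} := {x | x ∈ H θ}

section Hull

variable {θ : Cardinal.{u}} {M : Set ZFSet.{u}}

theorem isCountableSubmodel_iff : IsCountableSubmodel M θ ↔ M.Countable ∧ Submodel (HC θ) M := by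
  refine and_congr_right fun _ => ⟨fun h => ?_, fun h => ?_⟩
  · obtain ⟨h1, h2⟩ := meetsDefinable_of_elementary h
    exact ⟨h1, H_mem_trans, h2⟩
  · exact elementary_of_meetsDefinable h.subset h.meets

/-- A relation `P` that is definable over `H θ` with parameters from `M` has a Skolem function on
`D` in `M`. Hence, if `P x y` holds for some `y`, it does so for a `y` in `Hull(M, x)`. -/
theorem exists_mem_hull (hθ : θ.IsRegular) [hM : Submodel (HC θ) M] {D : ZFSet.{u}} (hD : D ∈ M)
    {P : ZFSet.{u} → ZFSet.{u} → Prop} [h : Dfn (HC θ) M (fun v : Fin 2 → HC θ => P (v 0) (v 1))]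
    {x y : ZFSet.{u}} (hx : x ∈ D) (hy : y ∈ H θ) (hP : P x y) : ∃ y ∈ hull M x, P x y := by
  have : Fact (D ∈ M) := ⟨hD⟩
  have hP' : ∀ (β : Type) (i j : β), Dfn (HC θ) M (fun w : β → HC θ => P (w i) (w j)) :=
    fun β i j => Dfn.comp (P := fun v : Fin 2 → HC θ => P (v 0) (v 1)) ![i, j]
  let E := D.sep (fun z => ∃ y ∈ H θ, P z y)
  have hE : ∀ z ∈ E, ∃ y ∈ H θ, P z y := fun z hz => (ZFSet.mem_sep.1 hz).2
  choose! F hF hPF using hE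
  obtain ⟨g, hg, hg1, hg2⟩ := Submodel.exists_mem (K := HC θ) (M := M)
    (P := fun g => IsFn g ∧ ∀ z ∈ D, ∀ y ∈ HC θ, P z y → ∃ y' ∈ HC θ, ZFSet.pair z y' ∈ g ∧ P z y')
    (a := img (fun z => ZFSet.pair z (F z)) E)
    (graph_mem_H hθ (H_subset_mem ZFSet.sep_subset (hM.subset hD)) hF)
    ⟨isFn_graph _ _, fun z hz y hy hzy => by
      have hzE : z ∈ E := ZFSet.mem_sep.2 ⟨hz, y, hy, hzy⟩
      exact ⟨F z, hF z hzE, pair_mem_graph.2 ⟨hzE, rfl⟩, hPF z hzE⟩⟩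
  obtain ⟨y', -, h1, h2⟩ := hg2 x hx y hy hP
  exact ⟨y', mem_hull.2 ⟨g, hg, hg1, h1⟩, h2⟩

/-- `Hull(M, x) ≺ H θ` if `x` is an element of a member of `M`. The parameters of a definition over
the hull are values at `x` of functions in `M`, so the definition can be read as one over `M` with
the further argument `x`, to which Skolem functions apply. -/
theorem hull_submodel (hθ : θ.IsRegular) [hM : Submodel (HC θ) M] {D x : ZFSet.{u}} (hD : D ∈ M)
    (hx : x ∈ D) : Submodel (HC θ) (hull M x) := by
  have hxK : x ∈ H θ := H_mem_trans hx (hM.subset hD)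
  refine ⟨fun y hy => ?_, H_mem_trans, ?_⟩
  · obtain ⟨f, hf, -, hxy⟩ := mem_hull.1 hy
    exact (pair_mem_trans (A := HC θ) H_mem_trans (H_mem_trans hxy (hM.subset hf))).2
  · rintro S ⟨b, hb⟩ hS
    obtain ⟨A, hA, hSA⟩ := Set.definable_iff_finitely_definable.1 hS
    obtain ⟨φ, hφ⟩ := Set.definable_iff_exists_formula_sum.1 hSA
    have hφ' : ∀ c : HC θ, c ∈ S ↔
        φ.Realize (Sum.elim (fun a : (A : Set (HC θ)) => (a : HC θ)) fun _ : Fin 1 => c) := by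
      intro c
      have := congrArg (fun S => (fun _ => c) ∈ S) hφ
      simpa only [Set.mem_ofPred_eq, eq_iff_iff] using this
    have hA' : ∀ a : (A : Set (HC θ)), ∃ f ∈ M, IsFn f ∧ ZFSet.pair x a.1.1 ∈ f :=
      fun a => mem_hull.1 (hA a.2)
    choose f hfM hfn hf using hA'
    have hfM' : ∀ a, Fact (f a ∈ M) := fun a => ⟨hfM a⟩
    have hφd : Dfn (HC θ) M (fun w : Fin 2 ⊕ (A : Set (HC θ)) → HC θ =>
        φ.Realize (Sum.elim (fun i => w (.inr i)) (fun _ => w (.inl 1)))) := by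
      refine ⟨Set.definable_iff_exists_formula_sum.2
        ⟨φ.relabel (Sum.elim (fun i => .inr (.inr i)) (fun _ => .inr (.inl 1))), ?_⟩⟩
      ext v
      rw [Set.mem_ofPred_eq, Set.mem_ofPred_eq, Language.Formula.realize_relabel, iff_iff_eq]
      congr 1
      funext i
      rcases i with i | i <;> rfl
    have hd : Dfn (HC θ) M (fun v : Fin 2 → HC θ => ∃ u : ↥(A : Set (HC θ)) → HC θ,
        (∀ a, ZFSet.pair (v 0) (u a) ∈ f a) ∧ φ.Realize (Sum.elim u (fun _ => v 1))) :=
      Dfn.ex_tuple (R := fun v u => (∀ a, ZFSet.pair (v 0) (u a) ∈ f a) ∧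
        φ.Realize (Sum.elim u (fun _ => v 1)))
    obtain ⟨y, hy, hyK, u, hu, hyu⟩ := exists_mem_hull hθ (M := M) hD
      (P := fun z y => ∃ hy : y ∈ HC θ, ∃ u : ↥(A : Set (HC θ)) → HC θ,
        (∀ a, ZFSet.pair z (u a) ∈ f a) ∧ φ.Realize (Sum.elim u (fun _ => ⟨y, hy⟩)))
      (h := @Dfn.congr _ _ _ _ _ (fun v => ⟨fun h => h.2, fun h => ⟨(v 1).2, h⟩⟩) hd)
      hx b.2 ⟨b.2, fun a => a, hf, (hφ' b).1 hb⟩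
    refine ⟨⟨y, hyK⟩, (hφ' _).2 ?_, hy⟩
    convert hyu using 3
    exact Subtype.ext ((hfn _).2 _ _ _ (hf _) (hu _))

theorem subset_hull (hθ : θ.IsRegular) [hM : Submodel (HC θ) M] {D x : ZFSet.{u}} (hD : D ∈ M)
    (hx : x ∈ D) : M ⊆ hull M x := by
  intro m hm
  have : Fact (m ∈ M) := ⟨hm⟩
  obtain ⟨y, hy, rfl⟩ := exists_mem_hull hθ (M := M) hD (P := fun _ y => y = m) hx
    (hM.subset hm) rfl
  exact hy

theorem mem_hull_self (hθ : θ.IsRegular) [hM : Submodel (HC θ) M] {D x : ZFSet.{u}} (hD : D ∈ M)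
    (hx : x ∈ D) : x ∈ hull M x := by
  obtain ⟨y, hy, rfl⟩ := exists_mem_hull hθ (M := M) hD (P := fun z y => y = z) hx
    (H_mem_trans hx (hM.subset hD)) rfl
  exact hy

/-- An elementary submodel is closed under application of its functions. -/
theorem Submodel.apply_mem {K : Set ZFSet.{u}} [hM : Submodel K M] {f x y : ZFSet.{u}} (hf : f ∈ M)
    (hx : x ∈ M) (hfn : IsFn f) (h : ZFSet.pair x y ∈ f) : y ∈ M := by
  have : Fact (f ∈ M) := ⟨hf⟩
  have : Fact (x ∈ M) := ⟨hx⟩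
  have hy := (pair_mem_trans (A := K) hM.trans (hM.trans h (hM.subset hf))).2
  obtain ⟨z, hz, hz'⟩ := Submodel.exists_mem (K := K) (M := M)
    (P := fun y => ZFSet.pair x y ∈ f) hy h
  rwa [hfn.2 _ _ _ h hz']

theorem hull_subset {K N : Set ZFSet.{u}} [hN : Submodel K N] (hMN : M ⊆ N) {x : ZFSet.{u}}
    (hx : x ∈ N) : hull M x ⊆ N := by
  intro y hy
  obtain ⟨f, hf, hfn, h⟩ := mem_hull.1 hy
  exact Submodel.apply_mem (K := K) (hMN hf) hx hfn h

theorem countable_hull (hM : M.Countable) (x : ZFSet.{u}) : (hull M x).Countable := by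
  have : hull M x ⊆ ⋃ f ∈ M, {y | IsFn f ∧ ZFSet.pair x y ∈ f} := by
    intro y hy
    obtain ⟨f, hf, h⟩ := mem_hull.1 hy
    exact Set.mem_biUnion hf h
  refine (hM.biUnion fun f _ => ?_).mono this
  exact Set.Subsingleton.countable fun y hy z hz => hy.1.2 _ _ _ hy.2 hz.2

end Hull

/-! ### The size of `H λ⁺` -/

theorem isTransitive_H (θ : Cardinal.{u}) : (H θ).IsTransitive :=
  fun _ hy _ hz => H_mem_trans hz hy

theorem isTransitive_insert_trcl (x : ZFSet.{u}) : (insert x (trcl x)).IsTransitive := by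
  intro y hy z hz
  rw [ZFSet.mem_insert_iff] at hy ⊢
  rcases hy with rfl | hy
  · exact Or.inr (subset_trcl _ hz)
  · exact Or.inr (isTransitive_trcl x y hy hz)

theorem card_insert_trcl_le {l : Cardinal.{u}} (hl : ℵ₀ ≤ l) {x : ZFSet.{u}}
    (hx : x ∈ H (Order.succ l)) : (insert x (trcl x)).card ≤ l :=
  ZFSet.card_insert_le.trans (add_le_of_le hl (Order.lt_succ_iff.1 (mem_H.1 hx))
    (one_le_aleph0.trans hl))

/-- There are at most `2 ^ λ` sets whose transitive closure has at most `λ` elements. -/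
theorem card_H_succ_le {l : Cardinal.{u}} (hl : ℵ₀ ≤ l) : (H (Order.succ l)).card ≤ 2 ^ l := by
  -- `x` is determined by a relation on `λ` isomorphic to membership on `{x} ∪ trcl x`, together
  -- with the point that corresponds to `x`.
  let T : ZFSet.{u} → ZFSet.{u} := fun x => insert x (trcl x)
  have he : ∀ x : H (Order.succ l), Nonempty ((T x.1 : Type _) ↪ l.out) := by
    intro x
    rw [← Cardinal.lift_mk_le'.{u + 1, u}, ZFSet.cardinalMk_coe_sort, mk_out, Cardinal.lift_lift,
      Cardinal.lift_umax.{u, u + 1}, Cardinal.lift_le]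
    exact card_insert_trcl_le hl x.2
  let e := fun x => (he x).some
  let R : H (Order.succ l) → Set (l.out × l.out) := fun x =>
    {p | ∃ y z : T x.1, y.1 ∈ z.1 ∧ e x y = p.1 ∧ e x z = p.2}
  let top : ∀ x : H (Order.succ l), T x.1 := fun x => ⟨x.1, ZFSet.mem_insert _ _⟩
  let code : H (Order.succ l) → l.out × Set (l.out × l.out) := fun x => (e x (top x), R x)
  have hcode : Function.Injective code := by
    intro x x' h
    have htop : e x (top x) = e x' (top x') := congrArg Prod.fst h
    have hR : R x = R x' := congrArg Prod.snd h
    have key : ∀ y : ZFSet.{u}, ∀ (hy : y ∈ T x.1) (y' : T x'.1),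
        e x ⟨y, hy⟩ = e x' y' → y = y' := by
      intro y
      induction y using ZFSet.inductionOn with
      | _ y ih =>
        intro hy y' hyy'
        ext z
        constructor
        · intro hz
          have hzT : z ∈ T x.1 := isTransitive_insert_trcl _ _ hy hz
          have : (e x ⟨z, hzT⟩, e x ⟨y, hy⟩) ∈ R x := ⟨⟨z, hzT⟩, ⟨y, hy⟩, hz, rfl, rfl⟩
          rw [hR] at this
          obtain ⟨w, v, hwv, h1, h2⟩ := this
          obtain rfl : v = y' := (e x').injective (h2.trans hyy')
          rwa [ih z hz hzT w h1.symm]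
        · intro hz
          have hzT : z ∈ T x'.1 := isTransitive_insert_trcl _ _ y'.2 hz
          have : (e x' ⟨z, hzT⟩, e x' y') ∈ R x' := ⟨⟨z, hzT⟩, y', hz, rfl, rfl⟩
          rw [← hR] at this
          obtain ⟨w, v, hwv, h1, h2⟩ := this
          obtain rfl : v = ⟨y, hy⟩ := (e x).injective (h2.trans hyy'.symm)
          have hwz : w.1 = z := ih w.1 hwv w.2 ⟨z, hzT⟩ h1
          rw [← hwz]
          exact hwv
    exact Subtype.ext (key x.1 _ (top x') htop)
  have := Cardinal.lift_mk_le_lift_mk_of_injective hcode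
  rw [ZFSet.cardinalMk_coe_sort, Cardinal.lift_lift, Cardinal.lift_umax.{u, u + 1},
    Cardinal.lift_le, mk_prod, mk_set, mk_prod] at this
  simp only [mk_out, Cardinal.lift_id, mul_eq_self hl] at this
  refine this.trans ?_
  rw [mul_eq_max hl (hl.trans (cantor l).le), max_eq_right (cantor l).le]

section

variable {θ l : Cardinal.{u}} {M : Set ZFSet.{u}}

theorem two_power_lt (h : MuchSmaller (cardSet l) θ) : 2 ^ l < θ := by
  have h1 : (cardSet l).powerset ∈ H θ :=
    H_mem_trans (ZFSet.mem_powerset.2 fun _ h => h) h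
  have := card_lt_of_mem_H h1
  rwa [ZFSet.card_powerset, cardSet, Ordinal.card_toZFSet, card_ord] at this

/-- An elementary submodel that contains `λ` has an element that includes `H λ`. -/
theorem exists_H_subset (hθ : θ.IsRegular) (hl : ℵ₀ ≤ l) (hs : MuchSmaller (cardSet l) θ)
    [hM : Submodel (HC θ) M] (hlM : cardSet l ∈ M) : ∃ D ∈ M, H l ⊆ D := by
  -- The witness is `H λ⁺` rather than `H λ`: being the range of a partial function on `λ` is easy
  -- to express over `H θ`.
  have : Fact (cardSet l ∈ M) := ⟨hlM⟩
  have h2 := two_power_lt hs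
  have hlθ : Order.succ l ≤ θ := Order.succ_le_of_lt ((cantor l).trans h2)
  have hc : (cardSet l).card = l := by rw [cardSet, Ordinal.card_toZFSet, card_ord]
  obtain ⟨D, hD, h⟩ := Submodel.exists_mem (K := HC θ) (M := M)
    (P := fun D => ∀ x ∈ HC θ, (∃ t ∈ HC θ, (∀ y ∈ t, y ⊆ t) ∧ x ∈ t ∧
      ∃ f ∈ HC θ, Covers f (cardSet l) t) → x ∈ D) (a := H (Order.succ l)) (by
        change _ ∈ H θ
        rw [mem_H, trcl_eq_self (isTransitive_H _)]
        exact (card_H_succ_le hl).trans_lt h2) (by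
        rintro x - ⟨t, -, ht, hxt, f, -, hf⟩
        rw [mem_H, Order.lt_succ_iff]
        have := hf.card_le
        rw [hc] at this
        exact (ZFSet.card_mono (trcl_subset ht (ht _ hxt))).trans this)
  refine ⟨D, hD, fun x hx => ?_⟩
  have hx' : x ∈ H (Order.succ l) := H_mono (Order.le_succ l) hx
  have hT := isTransitive_insert_trcl x
  have hTθ : insert x (trcl x) ∈ H θ := by
    rw [mem_H, trcl_eq_self hT]
    exact (card_insert_trcl_le hl hx').trans_lt ((cantor l).trans h2)
  refine h x (H_mono hlθ hx') ⟨_, hTθ, hT, ZFSet.mem_insert _ _,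
    exists_covers hθ (hM.subset hlM) hTθ ?_⟩
  rw [hc]
  exact card_insert_trcl_le hl hx'

/-! ### Countable ordinals in elementary submodels -/

instance Dfn.isOrdinal {K M : Set ZFSet.{u}} {α : Type*} {t : (α → K) → ZFSet.{u}}
    [hM : Submodel K M] [Tm K M t] : Dfn K M (fun v => (t v).IsOrdinal) :=
  have := Tm.inl (t := t) (K := K) (M := M)
  congr (Q := fun v => (∀ y ∈ t v, y ⊆ t v) ∧ ∀ y ∈ t v, ∀ z ∈ y, z ⊆ y)
    (fun _ => ZFSet.isOrdinal_iff_forall_mem_isTransitive)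

theorem toZFSet_mem_H {o : Ordinal.{u}} (h : o.card < θ) : o.toZFSet ∈ H θ := by
  rw [mem_H, trcl_eq_self (ZFSet.isOrdinal_toZFSet o).isTransitive, Ordinal.card_toZFSet]
  exact h

theorem omega_mem (hθ : ℵ₀ < θ) [hM : Submodel (HC θ) M] : cardSet ℵ₀ ∈ M := by
  -- `ω` is the least nonzero limit ordinal.
  obtain ⟨w, hw, h0, ⟨z, hz, -⟩, h1, h2⟩ := Submodel.exists_mem (K := HC θ) (M := M)
    (P := fun w => w.IsOrdinal ∧ (∃ z ∈ w, z = z) ∧ (∀ n ∈ w, ∃ m ∈ w, n ∈ m) ∧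
      ∀ v ∈ w, ¬ ((∃ z ∈ v, z = z) ∧ ∀ n ∈ v, ∃ m ∈ v, n ∈ m)) (a := cardSet ℵ₀)
      (toZFSet_mem_H (by rwa [card_ord])) (by
    rw [cardSet, ord_aleph0]
    refine ⟨ZFSet.isOrdinal_toZFSet _, ⟨∅, ?_, rfl⟩, ?_, ?_⟩
    · rw [← Ordinal.toZFSet_zero, Ordinal.toZFSet_mem_toZFSet_iff]
      exact Ordinal.omega0_pos
    · intro n hn
      obtain ⟨a, ha, rfl⟩ := Ordinal.mem_toZFSet_iff.1 hn
      exact ⟨_, Ordinal.toZFSet_mem_toZFSet_iff.2 (Ordinal.isSuccLimit_omega0.succ_lt ha),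
        Ordinal.toZFSet_mem_toZFSet_iff.2 (Order.lt_succ a)⟩
    · rintro v hv ⟨⟨z, hz, -⟩, h⟩
      obtain ⟨a, ha, rfl⟩ := Ordinal.mem_toZFSet_iff.1 hv
      obtain ⟨n, rfl⟩ := Ordinal.lt_omega0.1 ha
      obtain ⟨b, hb, rfl⟩ := Ordinal.mem_toZFSet_iff.1 hz
      cases n with
      | zero => simp at hb
      | succ n =>
        obtain ⟨m, hm, hm'⟩ := h (n : Ordinal).toZFSet (Ordinal.toZFSet_mem_toZFSet_iff.2
          (by exact_mod_cast n.lt_succ_self))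
        obtain ⟨c, hc, rfl⟩ := Ordinal.mem_toZFSet_iff.1 hm
        rw [Ordinal.toZFSet_mem_toZFSet_iff] at hm'
        have : ((n + 1 : ℕ) : Ordinal) ≤ c := by
          rw [Nat.cast_succ, ← Order.succ_eq_add_one]; exact Order.succ_le_of_lt hm'
        exact absurd hc this.not_gt)
  obtain ⟨o, rfl⟩ := ZFSet.isOrdinal_iff_mem_range_toZFSet.1 h0
  have hlim : Order.IsSuccLimit o := by
    refine ⟨?_, ?_⟩
    · rw [isMin_iff_eq_bot]
      rintro rfl
      rw [Ordinal.bot_eq_zero, Ordinal.toZFSet_zero] at hz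
      exact ZFSet.notMem_empty _ hz
    · intro a ha
      obtain ⟨m, hm, hm'⟩ := h1 _ (Ordinal.toZFSet_mem_toZFSet_iff.2 ha.lt)
      obtain ⟨c, hc, rfl⟩ := Ordinal.mem_toZFSet_iff.1 hm
      exact ha.2 (Ordinal.toZFSet_mem_toZFSet_iff.1 hm') hc
  rcases (Ordinal.omega0_le_of_isSuccLimit hlim).eq_or_lt with h | h
  · rwa [cardSet, ord_aleph0, h]
  · exfalso
    refine h2 _ (Ordinal.toZFSet_mem_toZFSet_iff.2 h) ⟨⟨∅, ?_, rfl⟩, ?_⟩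
    · rw [← Ordinal.toZFSet_zero, Ordinal.toZFSet_mem_toZFSet_iff]
      exact Ordinal.omega0_pos
    · intro n hn
      obtain ⟨a, ha, rfl⟩ := Ordinal.mem_toZFSet_iff.1 hn
      exact ⟨_, Ordinal.toZFSet_mem_toZFSet_iff.2 (Ordinal.isSuccLimit_omega0.succ_lt ha),
        Ordinal.toZFSet_mem_toZFSet_iff.2 (Order.lt_succ a)⟩

/-- `ω ⊆ M`. -/
theorem omega_subset (hθ : ℵ₀ < θ) [hM : Submodel (HC θ) M] {n : ZFSet.{u}}
    (hn : n ∈ cardSet ℵ₀) : n ∈ M := by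
  have : Fact (cardSet ℵ₀ ∈ M) := ⟨omega_mem hθ⟩
  rw [cardSet, ord_aleph0] at hn
  obtain ⟨a, ha, rfl⟩ := Ordinal.mem_toZFSet_iff.1 hn
  obtain ⟨n, rfl⟩ := Ordinal.lt_omega0.1 ha
  have hK : ∀ n : ℕ, (n : Ordinal.{u}).toZFSet ∈ H θ := fun n =>
    toZFSet_mem_H (by rw [Ordinal.card_nat]; exact natCast_lt_aleph0.trans hθ)
  clear hn ha
  induction n with
  | zero =>
    obtain ⟨w, hw, h⟩ := Submodel.exists_mem (K := HC θ) (M := M) (P := fun w => ∀ z ∈ w, z ≠ z)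
      (hK 0) (by simp)
    rwa [Nat.cast_zero, Ordinal.toZFSet_zero, ← (ZFSet.eq_empty w).2 fun z hz => h z hz rfl]
  | succ n ih =>
    have : Fact ((n : Ordinal.{u}).toZFSet ∈ M) := ⟨ih⟩
    obtain ⟨w, hw, h1, h2, h3⟩ := Submodel.exists_mem (K := HC θ) (M := M)
      (P := fun w => (n : Ordinal.{u}).toZFSet ∈ w ∧ (n : Ordinal.{u}).toZFSet ⊆ w ∧
        ∀ z ∈ w, z = (n : Ordinal.{u}).toZFSet ∨ z ∈ (n : Ordinal.{u}).toZFSet)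
      (hK (n + 1)) (by
        rw [Nat.cast_succ, Ordinal.toZFSet_add_one]
        exact ⟨ZFSet.mem_insert _ _, fun z hz => ZFSet.mem_insert_of_mem _ hz,
          fun z hz => ZFSet.mem_insert_iff.1 hz⟩)
    have : w = ((n + 1 : ℕ) : Ordinal.{u}).toZFSet := by
      rw [Nat.cast_succ, Ordinal.toZFSet_add_one]
      ext z
      rw [ZFSet.mem_insert_iff]
      exact ⟨h3 z, by rintro (rfl | h); exacts [h1, h2 h]⟩
    rwa [← this]

theorem card_omega_set : (cardSet.{u} ℵ₀).card = ℵ₀ := by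
  rw [cardSet, Ordinal.card_toZFSet, card_ord]

theorem card_omegaOne : omegaOne.{u}.card = ℵ_ 1 := by
  rw [omegaOne, cardSet, Ordinal.card_toZFSet, card_ord]

theorem mem_omegaOne {x : ZFSet.{u}} :
    x ∈ omegaOne ↔ ∃ a : Ordinal.{u}, a.card ≤ ℵ₀ ∧ a.toZFSet = x := by
  rw [omegaOne, cardSet, Ordinal.mem_toZFSet_iff]
  simp only [lt_ord, ← succ_aleph0, Order.lt_succ_iff]

theorem card_le_of_mem_omegaOne {x : ZFSet.{u}} (hx : x ∈ omegaOne) : x.card ≤ ℵ₀ := by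
  obtain ⟨a, ha, rfl⟩ := mem_omegaOne.1 hx
  rwa [Ordinal.card_toZFSet]

theorem isOrdinal_omegaOne : omegaOne.{u}.IsOrdinal := ZFSet.isOrdinal_toZFSet _

theorem omegaOne_mem_H (h1 : ℵ_ 1 < θ) : omegaOne ∈ H θ :=
  toZFSet_mem_H (by rwa [card_ord])

theorem omegaOne_mem (hθ : θ.IsRegular) (h1 : ℵ_ 1 < θ) [hM : Submodel (HC θ) M] :
    omegaOne ∈ M := by
  have h0 : ℵ₀ < θ := aleph0_lt_aleph_one.trans h1
  have hω : cardSet ℵ₀ ∈ M := omega_mem h0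
  have hωθ := hM.subset hω
  have : Fact (cardSet ℵ₀ ∈ M) := ⟨hω⟩
  -- `ω₁` is the least uncountable ordinal.
  obtain ⟨w, hw, hwo, hw1, hw2⟩ := Submodel.exists_mem (K := HC θ) (M := M)
    (P := fun w => w.IsOrdinal ∧ (¬ ∃ f ∈ HC θ, Covers f (cardSet ℵ₀) w) ∧
      ∀ v ∈ w, ∃ f ∈ HC θ, Covers f (cardSet ℵ₀) v) (omegaOne_mem_H h1) (by
    refine ⟨isOrdinal_omegaOne, ?_, fun v hv => ?_⟩
    · rintro ⟨f, -, hf⟩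
      have := hf.card_le
      rw [card_omega_set, card_omegaOne] at this
      exact this.not_gt aleph0_lt_aleph_one
    · exact exists_covers hθ hωθ (H_mem_trans hv (omegaOne_mem_H h1))
        (by rw [card_omega_set]; exact card_le_of_mem_omegaOne hv))
  convert hw
  rcases ZFSet.IsOrdinal.mem_trichotomous isOrdinal_omegaOne hwo with h | h | h
  · exfalso
    obtain ⟨f, -, hf⟩ := hw2 _ h
    have := hf.card_le
    rw [card_omega_set, card_omegaOne] at this
    exact this.not_gt aleph0_lt_aleph_one
  · exact h
  · exact absurd (exists_covers hθ hωθ (hM.subset hw)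
      (by rw [card_omega_set]; exact card_le_of_mem_omegaOne h)) hw1

theorem mem_delta {x : ZFSet.{u}} : x ∈ delta M ↔ x ∈ omegaOne ∧ x ∈ M := by
  rw [delta, ZFSet.mem_sep]

/-- `M ∩ ω₁` is an initial segment of `ω₁`. -/
theorem mem_of_mem_omegaOne (hθ : θ.IsRegular) (h1 : ℵ_ 1 < θ) [hM : Submodel (HC θ) M]
    {x y : ZFSet.{u}} (hxy : x ∈ y) (hy : y ∈ M) (hy1 : y ∈ omegaOne) : x ∈ M := by
  have h0 : ℵ₀ < θ := aleph0_lt_aleph_one.trans h1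
  have hω : cardSet ℵ₀ ∈ M := omega_mem h0
  have : Fact (cardSet ℵ₀ ∈ M) := ⟨hω⟩
  have : Fact (y ∈ M) := ⟨hy⟩
  obtain ⟨f, hf, hfω⟩ := exists_covers hθ (hM.subset hω) (hM.subset hy)
    (by rw [card_omega_set]; exact card_le_of_mem_omegaOne hy1)
  obtain ⟨f, hf, hfω⟩ := Submodel.exists_mem (K := HC θ) (M := M)
    (P := fun f => Covers f (cardSet ℵ₀) y) hf hfω
  obtain ⟨n, hn, h⟩ := hfω.2 x hxy
  exact Submodel.apply_mem (K := HC θ) hf (omega_subset h0 hn) hfω.1 h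

theorem card_le_aleph0_of_countable {x : ZFSet.{u}} (h : (x : Set ZFSet.{u}).Countable) :
    x.card ≤ ℵ₀ := by
  rw [← Cardinal.lift_le.{u + 1}, ← ZFSet.cardinalMk_coe_sort, lift_aleph0]
  exact Cardinal.le_aleph0_iff_set_countable.2 h

/-- For countable `M`, the set `M ∩ ω₁` is itself a countable ordinal. -/
theorem delta_mem_omegaOne (hθ : θ.IsRegular) (h1 : ℵ_ 1 < θ) [hM : Submodel (HC θ) M]
    (hc : M.Countable) : delta M ∈ omegaOne := by
  have hord : (delta M).IsOrdinal := by
    rw [ZFSet.isOrdinal_iff_forall_mem_isTransitive]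
    refine ⟨fun y hy z hz => ?_, fun y hy => ?_⟩
    · rw [mem_delta] at hy ⊢
      exact ⟨isOrdinal_omegaOne.mem_trans hz hy.1, mem_of_mem_omegaOne hθ h1 hz hy.2 hy.1⟩
    · exact (isOrdinal_omegaOne.mem (mem_delta.1 hy).1).isTransitive
  obtain ⟨o, ho⟩ := ZFSet.isOrdinal_iff_mem_range_toZFSet.1 hord
  refine mem_omegaOne.2 ⟨o, ?_, ho⟩
  rw [← Ordinal.card_toZFSet, ho]
  exact card_le_aleph0_of_countable (hc.mono fun x hx => (mem_delta.1 hx).2)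

/-- Countable sets of countable ordinals are bounded below `ω₁`. -/
theorem exists_bound {A : ZFSet.{u}} (hA : A ⊆ omegaOne) (hc : A.card ≤ ℵ₀) :
    ∃ γ ∈ omegaOne, A ⊆ γ := by
  have hU : ∀ a ∈ A, a.IsOrdinal := fun a ha => isOrdinal_omegaOne.mem (hA ha)
  by_contra! hcon
  have hcov : omegaOne.{u} ⊆ A ∪ ZFSet.sUnion A := by
    intro γ hγ
    have := hcon γ hγ
    obtain ⟨a, ha, ha'⟩ : ∃ a ∈ A, a ∉ γ := by
      by_contra! h
      exact this h
    rw [(hU a ha).notMem_iff_subset (isOrdinal_omegaOne.mem hγ)] at ha'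
    rw [ZFSet.IsOrdinal.subset_iff_eq_or_mem (isOrdinal_omegaOne.mem hγ) (hU a ha)] at ha'
    rw [ZFSet.mem_union, ZFSet.mem_sUnion]
    rcases ha' with rfl | h
    · exact Or.inl ha
    · exact Or.inr ⟨a, ha, h⟩
  have hcount : ((A ∪ ZFSet.sUnion A : ZFSet.{u}) : Set ZFSet.{u}).Countable := by
    have cnt : ∀ x : ZFSet.{u}, x.card ≤ ℵ₀ → (x : Set ZFSet.{u}).Countable := fun x hx => by
      rw [← Cardinal.le_aleph0_iff_set_countable, ← lift_aleph0.{u + 1, u}]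
      exact (ZFSet.cardinalMk_coe_sort (x := x)).trans_le (Cardinal.lift_le.2 hx)
    rw [ZFSet.coe_union, ZFSet.coe_sUnion, Set.sUnion_image]
    exact (cnt A hc).union ((cnt A hc).biUnion fun a ha => cnt a (card_le_of_mem_omegaOne (hA ha)))
  have := (ZFSet.card_mono hcov).trans (card_le_aleph0_of_countable hcount)
  rw [card_omegaOne] at this
  exact this.not_gt aleph0_lt_aleph_one

end

/-! ### Countable submodels that contain `λ` -/

/-- The assumptions on the two cardinals: both are regular and `θ ≫ λ ≥ ω₂`. -/
structure Params (θ l : Cardinal.{u}) : Prop where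
  reg : θ.IsRegular
  reg' : l.IsRegular
  le : ℵ_ 2 ≤ l
  much : MuchSmaller (cardSet l) θ

/-- A countable elementary submodel of `H θ` that contains `λ`. -/
structure Good (θ l : Cardinal.{u}) (M : Set ZFSet.{u}) : Prop where
  countable : M.Countable
  sub : Submodel (HC θ) M
  mem : cardSet l ∈ M

theorem delta_eq_of_subset {A B C : Set ZFSet.{u}} (hAB : A ⊆ B) (hBC : B ⊆ C)
    (h : delta C = delta A) : delta B = delta A := by
  ext x
  constructor
  · intro hx
    rw [← h]
    rw [mem_delta] at hx ⊢
    exact ⟨hx.1, hBC hx.2⟩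
  · intro hx
    rw [mem_delta] at hx ⊢
    exact ⟨hx.1, hAB hx.2⟩

section

variable {θ l : Cardinal.{u}} {M N : Set ZFSet.{u}}

theorem Params.aleph_one_lt (p : Params θ l) : ℵ_ 1 < l :=
  (aleph_lt_aleph.2 (by norm_num)).trans_le p.le

theorem Params.lt (p : Params θ l) : l < θ := (cantor l).trans (two_power_lt p.much)

theorem Params.aleph_one_lt' (p : Params θ l) : ℵ_ 1 < θ := p.aleph_one_lt.trans p.lt

theorem Params.omegaOne_subset (p : Params θ l) : omegaOne ⊆ H l :=
  fun _ h => H_mem_trans h (omegaOne_mem_H p.aleph_one_lt)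

theorem Params.mem_H (p : Params θ l) {x : ZFSet.{u}} (hx : x ⊆ H l) (hc : x.card ≤ ℵ_ 1) :
    x ∈ H l :=
  mem_H_of_subset p.reg' hx (hc.trans_lt p.aleph_one_lt)

theorem Good.omegaOne_mem (p : Params θ l) (hM : Good θ l M) : omegaOne ∈ M :=
  have := hM.sub
  CapturingGame.omegaOne_mem p.reg p.aleph_one_lt'

theorem Good.delta_mem (p : Params θ l) (hM : Good θ l M) : delta M ∈ omegaOne :=
  have := hM.sub
  delta_mem_omegaOne p.reg p.aleph_one_lt' hM.countable

theorem Good.hull (p : Params θ l) (hM : Good θ l M) {x : ZFSet.{u}} (hx : x ∈ H l) :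
    Good θ l (hull M x) ∧ M ⊆ CapturingGame.hull M x ∧ x ∈ CapturingGame.hull M x := by
  have := hM.sub
  obtain ⟨D, hD, hlD⟩ := exists_H_subset p.reg p.reg'.aleph0_le p.much hM.mem
  have hs := subset_hull p.reg hD (hlD hx)
  exact ⟨⟨countable_hull hM.countable x, hull_submodel p.reg hD (hlD hx), hs hM.mem⟩, hs,
    mem_hull_self p.reg hD (hlD hx)⟩

/-- An element of an extension of `M` with the same countable ordinals adds no countable ordinals
to `M`. -/
theorem parallel_of_mem (p : Params θ l) (hM : Good θ l M) (hN : Good θ l N) (hMN : M ⊆ N)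
    (hd : delta N = delta M) {x : ZFSet.{u}} (hx : x ∈ H l) (hxN : x ∈ N) : Parallel x M :=
  have := hN.sub
  delta_eq_of_subset (hM.hull p hx).2.1 (hull_subset (K := HC θ) hMN hxN) hd

open Classical in
theorem IsFn.card_le {f d : ZFSet.{u}} (hf : IsFn f) (h : ∀ a b, ZFSet.pair a b ∈ f → a ∈ d) :
    f.card ≤ d.card := by
  let F : ZFSet.{u} → ZFSet.{u} := fun a =>
    if h : ∃ b, ZFSet.pair a b ∈ f then h.choose else ∅
  refine (ZFSet.card_mono (y := img (fun a => ZFSet.pair a (F a)) d) fun q hq => ?_).trans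
    card_img_le
  obtain ⟨a, b, rfl⟩ := hf.1 q hq
  have hex : ∃ b, ZFSet.pair a b ∈ f := ⟨b, hq⟩
  refine pair_mem_graph.2 ⟨h a b hq, ?_⟩
  simp only [F, dif_pos hex]
  exact hf.2 _ _ _ hex.choose_spec hq

/-- Functions from a subset of `ω₁` into `H λ` belong to `H λ`. -/
theorem Params.fn_mem_H (p : Params θ l) {f : ZFSet.{u}} (hf : IsFn f)
    (h : ∀ a b, ZFSet.pair a b ∈ f → a ∈ omegaOne ∧ b ∈ H l) : f ∈ H l := by
  refine p.mem_H (fun q hq => ?_) ?_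
  · obtain ⟨a, b, rfl⟩ := hf.1 q hq
    have := h a b hq
    exact pair_mem_H p.reg' (p.omegaOne_subset this.1) this.2
  · rw [← card_omegaOne]
    exact hf.card_le fun a b hab => (h a b hab).1

/-! ### From capturing to covering -/

open Classical in
/-- If player two can answer the challenge `X`, then `X` is covered by a set `Y ∥ M` of size `ℵ₁`:
the union of all values of size at most `ℵ₁` of the answer. -/
theorem exists_parallel_superset (p : Params θ l) (hM : Good θ l M) {X f : ZFSet.{u}}
    (hc : X.card = ℵ_ 1) (hf : LegalAnswer (H l) M X f) :
    ∃ Y : ZFSet.{u}, Y ⊆ H l ∧ Y.card = ℵ_ 1 ∧ X ⊆ Y ∧ Parallel Y M := by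
  obtain ⟨hf, hfX, hpar⟩ := hf
  obtain ⟨hfn, -, hfd⟩ := isFunc_iff.1 hf
  have hfl : f ∈ H l := p.fn_mem_H hfn hfd
  obtain ⟨hN, hMN, hfN⟩ := hM.hull p hfl
  have := hN.sub
  let G : ZFSet.{u} → ZFSet.{u} := fun a =>
    if h : ∃ z, ZFSet.pair a z ∈ f ∧ z.card ≤ ℵ_ 1 then h.choose else ∅
  have hG : ∀ a z, ZFSet.pair a z ∈ f → z.card ≤ ℵ_ 1 → G a = z := fun a z hz hzc => by
    have h : ∃ z, ZFSet.pair a z ∈ f ∧ z.card ≤ ℵ_ 1 := ⟨z, hz, hzc⟩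
    simp only [G, dif_pos h]
    exact hfn.2 _ _ _ h.choose_spec.1 hz
  have hG' : ∀ a y, y ∈ G a → ZFSet.pair a (G a) ∈ f ∧ (G a).card ≤ ℵ_ 1 := fun a y hy => by
    by_cases h : ∃ z, ZFSet.pair a z ∈ f ∧ z.card ≤ ℵ_ 1
    · simp only [G, dif_pos h]
      exact h.choose_spec
    · simp [G, dif_neg h] at hy
  let Y : ZFSet.{u} := ZFSet.iUnion fun i : Shrink.{u} omegaOne.{u} =>
    G ((equivShrink omegaOne.{u}).symm i).1
  have hY : ∀ y, y ∈ Y ↔ ∃ a ∈ omegaOne, y ∈ G a := fun y => by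
    rw [ZFSet.mem_iUnion]
    constructor
    · rintro ⟨i, hi⟩
      exact ⟨_, ((equivShrink omegaOne.{u}).symm i).2, hi⟩
    · rintro ⟨a, ha, h⟩
      exact ⟨equivShrink omegaOne.{u} ⟨a, ha⟩, by simpa using h⟩
  have hYl : Y ⊆ H l := fun y hy => by
    obtain ⟨a, -, ha⟩ := (hY y).1 hy
    exact H_mem_trans ha (hfd _ _ (hG' a y ha).1).2
  have hYc : Y.card ≤ ℵ_ 1 := by
    have h := ZFSet.lift_card_iUnion_le_sum_card (f := fun i : Shrink.{u} omegaOne.{u} =>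
      G ((equivShrink omegaOne.{u}).symm i).1)
    rw [lift_id] at h
    refine h.trans ((Cardinal.sum_le_sum _ (fun _ => ℵ_ 1) fun i => ?_).trans ?_)
    · rcases ZFSet.eq_empty_or_nonempty (G ((equivShrink omegaOne.{u}).symm i).1) with h | ⟨y, hy⟩
      · rw [h, ZFSet.card_empty]; exact zero_le
      · exact (hG' _ y hy).2
    · rw [sum_const']
      change omegaOne.card * _ ≤ _
      rw [card_omegaOne, mul_eq_self (aleph0_le_aleph 1)]
  have hXY : X ⊆ Y := fun y hy => (hY y).2
    ⟨_, hM.delta_mem p, by rwa [hG _ _ hfX hc.le]⟩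
  have hYl' : Y ∈ H l := p.mem_H hYl hYc
  refine ⟨Y, hYl, le_antisymm hYc (hc ▸ ZFSet.card_mono hXY), hXY,
    parallel_of_mem p hM hN hMN hpar hYl' ?_⟩
  have h1 : Fact (omegaOne ∈ hull M f) := ⟨hN.omegaOne_mem p⟩
  have h2 : Fact (f ∈ hull M f) := ⟨hfN⟩
  have hYc' : ∀ y, y ∈ Y ↔ ∃ z ∈ HC θ, ∃ a ∈ omegaOne, ZFSet.pair a z ∈ f ∧ y ∈ z ∧
      ∃ e ∈ HC θ, Covers e omegaOne z := fun y => by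
    rw [hY]
    constructor
    · rintro ⟨a, ha, hy⟩
      have h := hG' a y hy
      have hz : G a ∈ H θ := H_mono p.lt.le (hfd _ _ h.1).2
      exact ⟨G a, hz, a, ha, h.1, hy, exists_covers p.reg (omegaOne_mem_H p.aleph_one_lt') hz
        (by rw [card_omegaOne]; exact h.2)⟩
    · rintro ⟨z, -, a, ha, hz, hy, e, -, he⟩
      have := he.card_le
      rw [card_omegaOne] at this
      exact ⟨a, ha, by rwa [hG a z hz this]⟩
  obtain ⟨Y', hY', h⟩ := Submodel.exists_mem (K := HC θ) (M := hull M f)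
    (P := fun Y' => ∀ y ∈ HC θ, y ∈ Y' ↔ ∃ z ∈ HC θ, ∃ a ∈ omegaOne, ZFSet.pair a z ∈ f ∧ y ∈ z ∧
      ∃ e ∈ HC θ, Covers e omegaOne z) (H_mono p.lt.le hYl') (fun y _ => hYc' y)
  convert hY'
  ext y
  constructor
  · intro hy
    exact (h y (H_mono p.lt.le (hYl hy))).2 ((hYc' y).1 hy)
  · intro hy
    exact (hYc' y).2 ((h y (H_mem_trans hy (hN.sub.subset hY'))).1 hy)

/-! ### From covering to capturing -/

/-- The instance of `Glob-SCC^cof` for `θ` and `λ`. -/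
def SCCcof (θ l : Cardinal.{u}) : Prop :=
  ∀ M : Set ZFSet.{u}, Good θ l M → ∀ X : ZFSet.{u}, X ⊆ H l → X.card = ℵ_ 1 →
    ∃ Y : ZFSet.{u}, Y ⊆ H l ∧ Y.card = ℵ_ 1 ∧ X ⊆ Y ∧ Parallel Y M

/-- Any `X ⊆ H λ` with at most `ℵ₁` elements is covered by the range of a function on `ω₁` that
belongs to a larger model with the same countable ordinals. -/
theorem SCCcof.exists_covers (hG : SCCcof θ l) (p : Params θ l) (hM : Good θ l M) {X : ZFSet.{u}}
    (hX : X ⊆ H l) (hc : X.card ≤ ℵ_ 1) : ∃ N Y e, Good θ l N ∧ M ⊆ N ∧ delta N = delta M ∧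
      Y ∈ N ∧ Y ⊆ H l ∧ X ⊆ Y ∧ e ∈ N ∧ Covers e omegaOne Y := by
  obtain ⟨Y, hYl, hYc, hXY, hY⟩ := hG M hM (X ∪ omegaOne)
    (fun z hz => (ZFSet.mem_union.1 hz).elim (fun h => hX h) fun h => p.omegaOne_subset h)
    (le_antisymm (ZFSet.card_union_le.trans (by
      rw [card_omegaOne]; exact add_le_of_le (aleph0_le_aleph 1) hc le_rfl))
      (by rw [← card_omegaOne]; exact ZFSet.card_mono fun z hz => ZFSet.mem_union.2 (Or.inr hz)))
  obtain ⟨hN, hMN, hYN⟩ := hM.hull p (p.mem_H hYl hYc.le)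
  have := hN.sub
  have h1 : Fact (omegaOne ∈ hull M Y) := ⟨hN.omegaOne_mem p⟩
  have h2 : Fact (Y ∈ hull M Y) := ⟨hYN⟩
  obtain ⟨e, he, hcov⟩ := CapturingGame.exists_covers p.reg (omegaOne_mem_H p.aleph_one_lt')
    (hN.sub.subset hYN) (by rw [card_omegaOne, hYc])
  obtain ⟨e, he, hcov⟩ := Submodel.exists_mem (K := HC θ) (M := hull M Y)
    (P := fun e => Covers e omegaOne Y) he hcov
  exact ⟨_, Y, e, hN, hMN, hY, hYN, hYl,
    fun z hz => hXY (ZFSet.mem_union.2 (Or.inl hz)), he, hcov⟩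

theorem submodel_iUnion {N : ℕ → Set ZFSet.{u}} (hmono : Monotone N)
    (h : ∀ n, Submodel (HC θ) (N n)) : Submodel (HC θ) (⋃ n, N n) := by
  refine ⟨Set.iUnion_subset fun n => (h n).subset, H_mem_trans, ?_⟩
  intro S hS hSd
  obtain ⟨A, hA, hSA⟩ := Set.definable_iff_finitely_definable.1 hSd
  have hA' : ∀ a ∈ A, ∃ n, a.1 ∈ N n := fun a ha => Set.mem_iUnion.1 (hA ha)
  choose! k hk using hA'
  obtain ⟨b, hb, hbN⟩ := (h (A.sup k)).meets S hS
    (hSA.mono fun a ha => hmono (Finset.le_sup ha) (hk a ha))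
  exact ⟨b, hb, Set.mem_iUnion.2 ⟨_, hbN⟩⟩

/-- Every countable `N ≺ H θ` that contains `λ` has an extension `N'` of that kind with the same
countable ordinals such that `x` is the value at `δ(N)` of some function in `N'`. -/
def Reachable (θ l : Cardinal.{u}) (x : ZFSet.{u}) : Prop :=
  ∀ N, Good θ l N → ∃ N', Good θ l N' ∧ N ⊆ N' ∧ delta N' = delta N ∧ x ∈ hull N' (delta N)

open Classical in
/-- Countably many reachable ordinals can be bounded simultaneously by an element of a hull
`Hull(N', δ)` of an extension `N'` with `N' ∩ ω₁ = δ`. -/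
theorem SCCcof.exists_bound (hG : SCCcof θ l) (p : Params θ l) {s : ℕ → ZFSet.{u}}
    (hs : ∀ n, Reachable θ l (s n)) (hs1 : ∀ n, s n ∈ omegaOne) (hN : Good θ l N) :
    ∃ N', Good θ l N' ∧ N ⊆ N' ∧ delta N' = delta N ∧
      ∃ γ ∈ omegaOne, γ ∈ hull N' (delta N) ∧ ∀ n, s n ∈ γ := by
  have hω := hN.delta_mem p
  generalize hδ : delta N = δ at hω ⊢
  -- The union `⋃ n, c n` of a chain of extensions of `N` contains, for each `n`, a function with
  -- value `s n` at `δ`.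
  let A := {N' : Set ZFSet.{u} // Good θ l N' ∧ delta N' = δ}
  have hstep : ∀ (n : ℕ) (B : A), ∃ C : A, B.1 ⊆ C.1 ∧ s n ∈ hull C.1 δ := by
    rintro n ⟨B, hB, rfl⟩
    obtain ⟨C, hC, hBC, hd, h⟩ := hs n B hB
    exact ⟨⟨C, hC, hd⟩, hBC, h⟩
  choose step hsub hmem using hstep
  let c : ℕ → A := fun n => n.rec ⟨N, hN, hδ⟩ step
  have hmono : Monotone fun n => (c n).1 := monotone_nat_of_le_succ fun n => hsub n (c n)
  have hNc : N ⊆ ⋃ n, (c n).1 := Set.subset_iUnion (fun n => (c n).1) 0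
  have hU : Good θ l (⋃ n, (c n).1) :=
    ⟨Set.countable_iUnion fun n => (c n).2.1.countable,
      submodel_iUnion hmono fun n => (c n).2.1.sub, hNc hN.mem⟩
  have hdU : delta (⋃ n, (c n).1) = δ := by
    ext x
    rw [mem_delta, Set.mem_iUnion]
    constructor
    · rintro ⟨hx, n, hn⟩
      rw [← (c n).2.2, mem_delta]
      exact ⟨hx, hn⟩
    · intro hx
      rw [← hδ, mem_delta] at hx
      exact ⟨hx.1, 0, hx.2⟩
  -- Restriction to `ω₁ × ω₁` makes these functions elements of `H λ`.
  have hg : ∀ n, ∃ g ∈ ⋃ n, (c n).1, IsFn g ∧ (∀ a b, ZFSet.pair a b ∈ g → a ∈ omegaOne ∧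
      b ∈ omegaOne) ∧ ZFSet.pair δ (s n) ∈ g := by
    intro n
    have := hU.sub
    obtain ⟨f, hf, hfn, hfs⟩ := mem_hull.1 (hmem n (c n))
    have hfU : f ∈ ⋃ n, (c n).1 := Set.mem_iUnion.2 ⟨n + 1, hf⟩
    have i1 : Fact (f ∈ ⋃ n, (c n).1) := ⟨hfU⟩
    have i2 : Fact (omegaOne ∈ ⋃ n, (c n).1) := ⟨hU.omegaOne_mem p⟩
    obtain ⟨g, hg, hgf, hg1, hg2⟩ := Submodel.exists_mem (K := HC θ) (M := ⋃ n, (c n).1)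
      (P := fun g => g ⊆ f ∧ (∀ q ∈ g, ∃ a ∈ omegaOne, ∃ b ∈ omegaOne, q = ZFSet.pair a b) ∧
        ∀ a ∈ omegaOne, ∀ b ∈ omegaOne, ZFSet.pair a b ∈ f → ZFSet.pair a b ∈ g)
      (a := f.sep fun q => ∃ a ∈ omegaOne, ∃ b ∈ omegaOne, q = ZFSet.pair a b)
      (H_subset_mem ZFSet.sep_subset (hU.sub.subset hfU))
      ⟨ZFSet.sep_subset, fun q hq => (ZFSet.mem_sep.1 hq).2,
        fun a ha b hb hab => ZFSet.mem_sep.2 ⟨hab, a, ha, b, hb, rfl⟩⟩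
    refine ⟨g, hg, hfn.subset hgf, fun a b hab => ?_, hg2 _ hω _ (hs1 n) hfs⟩
    obtain ⟨a', ha', b', hb', h⟩ := hg1 _ hab
    obtain ⟨rfl, rfl⟩ := ZFSet.pair_inj.1 h
    exact ⟨ha', hb'⟩
  choose g hgU hgn hgd hgs using hg
  -- A further extension contains an enumeration `e` on `ω₁` of a set that includes all of them.
  obtain ⟨N', Y, e, hN', hUN', hdN', hYN', hYl, hXY, heN', hcov⟩ := hG.exists_covers p hU
    (X := ZFSet.range g) (fun z hz => by
      obtain ⟨n, rfl⟩ := ZFSet.mem_range.1 hz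
      exact p.fn_mem_H (hgn n) fun a b hab =>
        ⟨(hgd n a b hab).1, p.omegaOne_subset (hgd n a b hab).2⟩) (by
      have := ZFSet.lift_card_range_le (f := g)
      rw [Cardinal.lift_uzero, mk_nat, lift_aleph0] at this
      exact this.trans (aleph0_le_aleph 1))
  rw [hdU] at hdN'
  refine ⟨N', hN', hNc.trans hUN', hdN', ?_⟩
  have i0 := hN'.sub
  have h1N' := hN'.omegaOne_mem p
  have hQsub := subset_hull p.reg h1N' hω
  have i1 : Submodel (HC θ) (hull N' δ) := hull_submodel p.reg h1N' hω
  have i2 : Fact (δ ∈ hull N' δ) := ⟨mem_hull_self p.reg h1N' hω⟩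
  have i3 : Fact (omegaOne ∈ hull N' δ) := ⟨hQsub h1N'⟩
  have i4 : Fact (e ∈ hull N' δ) := ⟨hQsub heN'⟩
  have i5 : Fact (e ∈ N') := ⟨heN'⟩
  have i6 : Fact (omegaOne ∈ N') := ⟨h1N'⟩
  -- The countably many ordinals `e(ξ)(δ)` with `ξ < δ` have a bound below `ω₁`, by elementarity one
  -- in `Hull(N', δ)`.
  let R : ZFSet.{u} → ZFSet.{u} → Prop := fun ξ y =>
    ∃ g, ZFSet.pair ξ g ∈ e ∧ IsFn g ∧ ZFSet.pair δ y ∈ g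
  have hR : ∀ ξ y z, R ξ y → R ξ z → y = z := by
    rintro ξ y z ⟨g, hg, hgn, hgy⟩ ⟨g', hg', -, hgz⟩
    obtain rfl := hcov.1.2 _ _ _ hg hg'
    exact hgn.2 _ _ _ hgy hgz
  let F : ZFSet.{u} → ZFSet.{u} := fun ξ => if h : ∃ y, R ξ y then h.choose else ∅
  have hF : ∀ ξ y, R ξ y → F ξ = y := fun ξ y hy => by
    have h : ∃ y, R ξ y := ⟨y, hy⟩
    simp only [F, dif_pos h]
    exact hR _ _ _ h.choose_spec hy
  obtain ⟨γ₀, hγ₀, hb⟩ := CapturingGame.exists_bound (A := omegaOne.sep fun y => ∃ ξ ∈ δ, R ξ y)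
    ZFSet.sep_subset (by
      refine (ZFSet.card_mono (y := img F δ) fun y hy => ?_).trans
        (card_img_le.trans (card_le_of_mem_omegaOne hω))
      obtain ⟨ξ, hξ, hy⟩ := (ZFSet.mem_sep.1 hy).2
      exact mem_img.2 ⟨ξ, hξ, hF ξ y hy⟩)
  obtain ⟨γ, hγ, hγ1, hγb⟩ := Submodel.exists_mem (K := HC θ) (M := hull N' δ)
    (P := fun γ => γ ∈ omegaOne ∧ ∀ ξ ∈ δ, ∀ g ∈ HC θ, ∀ y ∈ omegaOne, ZFSet.pair ξ g ∈ e →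
      IsFn g → ZFSet.pair δ y ∈ g → y ∈ γ)
    (H_mem_trans hγ₀ (omegaOne_mem_H p.aleph_one_lt'))
    ⟨hγ₀, fun ξ hξ g _ y hy h1 h2 h3 => hb (ZFSet.mem_sep.2 ⟨hy, ξ, hξ, g, h1, h2, h3⟩)⟩
  refine ⟨γ, hγ1, hγ, fun n => ?_⟩
  -- As `g n ∈ N'`, it is `e(ξ)` for some `ξ ∈ N' ∩ ω₁ = δ`.
  have i7 : Fact (g n ∈ N') := ⟨hUN' (hgU n)⟩
  obtain ⟨ξ₀, hξ₀, hξe⟩ := hcov.2 (g n) (hXY (ZFSet.mem_range.2 ⟨n, rfl⟩))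
  obtain ⟨ξ, hξ, hξ1, hξe⟩ := Submodel.exists_mem (K := HC θ) (M := N')
    (P := fun ξ => ξ ∈ omegaOne ∧ ZFSet.pair ξ (g n) ∈ e)
    (H_mem_trans hξ₀ (omegaOne_mem_H p.aleph_one_lt')) ⟨hξ₀, hξe⟩
  refine hγb ξ ?_ (g n) (hN'.sub.subset (hUN' (hgU n))) (s n) (hs1 n) hξe (hgn n) (hgs n)
  rw [← hdN', mem_delta]
  exact ⟨hξ1, hξ⟩

/-- Every countable ordinal is reachable: by induction all smaller ordinals are, a bound of them in
`Hull(N', δ)` is at least `o`, and `Hull(N', δ) ∩ ω₁` is an initial segment of `ω₁`. -/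
theorem SCCcof.reachable (hG : SCCcof θ l) (p : Params θ l) (o : Ordinal.{u}) :
    o.card ≤ ℵ₀ → Reachable θ l o.toZFSet := by
  induction o using WellFoundedLT.induction with
  | _ o ih =>
    intro ho N hN
    have h1N := hN.omegaOne_mem p
    have hω := hN.delta_mem p
    rcases eq_or_ne o 0 with rfl | ho0
    · have := hN.sub
      refine ⟨N, hN, subset_rfl, rfl, subset_hull p.reg h1N hω ?_⟩
      refine omega_subset (aleph0_lt_aleph_one.trans p.aleph_one_lt') ?_
      rw [cardSet, ord_aleph0, Ordinal.toZFSet_mem_toZFSet_iff]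
      exact Ordinal.omega0_pos
    · have : Countable (Set.Iio o) := by
        rw [← mk_le_aleph0_iff, mk_Iio_ordinal, ← lift_aleph0.{u + 1, u}, Cardinal.lift_le]
        exact ho
      have : Nonempty (Set.Iio o) := ⟨⟨0, pos_of_ne_zero ho0⟩⟩
      obtain ⟨s, hs⟩ := exists_surjective_nat (Set.Iio o)
      have hsc : ∀ n, (s n).1.card ≤ ℵ₀ := fun n => (Ordinal.card_le_card (s n).2.le).trans ho
      obtain ⟨N', hN', hNN', hd, γ, hγ1, hγ, hsγ⟩ := hG.exists_bound p
        (s := fun n => (s n).1.toZFSet) (fun n => ih _ (s n).2 (hsc n))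
        (fun n => mem_omegaOne.2 ⟨_, hsc n, rfl⟩) hN
      refine ⟨N', hN', hNN', hd, ?_⟩
      obtain ⟨a, -, rfl⟩ := mem_omegaOne.1 hγ1
      have hoa : o ≤ a := by
        by_contra! h
        obtain ⟨n, hn⟩ := hs ⟨a, h⟩
        have := Ordinal.toZFSet_mem_toZFSet_iff.1 (hsγ n)
        rw [hn] at this
        exact this.false
      have := hN'.sub
      have : Submodel (HC θ) (hull N' (delta N)) :=
        hull_submodel p.reg (hN'.omegaOne_mem p) hω
      rcases hoa.eq_or_lt with rfl | h
      · exact hγ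
      · exact mem_of_mem_omegaOne p.reg p.aleph_one_lt' (Ordinal.toZFSet_mem_toZFSet_iff.2 h) hγ hγ1

open Classical in
/-- Player two can answer every challenge in a single round: if `x = e(α)` with `α < ω₁` and `h` is
a function with `h(δ) = α`, then `f = e ∘ h` is an answer. -/
theorem SCCcof.exists_legalAnswer (hG : SCCcof θ l) (p : Params θ l) (hM : Good θ l M)
    {x : ZFSet.{u}} (hx : x ∈ H l) : ∃ f, LegalAnswer (H l) M x f := by
  obtain ⟨N, Y, e, hN, hMN, hdN, hYN, hYl, hxY, heN, hcov⟩ := hG.exists_covers p hM (X := {x})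
    (fun z hz => by rwa [ZFSet.mem_singleton.1 hz])
    (by rw [ZFSet.card_singleton]; exact one_le_aleph0.trans (aleph0_le_aleph 1))
  have hxY : x ∈ Y := hxY (ZFSet.mem_singleton.2 rfl)
  obtain ⟨α, hα, hαx⟩ := hcov.2 x hxY
  obtain ⟨a, ha, rfl⟩ := mem_omegaOne.1 hα
  obtain ⟨N', hN', hNN', hdN', hr⟩ := hG.reachable p a ha N hN
  rw [hdN] at hr hdN'
  obtain ⟨h, hh, hhn, hhα⟩ := mem_hull.1 hr
  have i0 := hN'.sub
  have i1 : Fact (omegaOne ∈ N') := ⟨hN'.omegaOne_mem p⟩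
  have i2 : Fact (Y ∈ N') := ⟨hNN' hYN⟩
  have i3 : Fact (e ∈ N') := ⟨hNN' heN⟩
  have i4 : Fact (h ∈ N') := ⟨hh⟩
  -- `R` is the graph of `e ∘ h`, and `F` is an extension of this partial function to all sets.
  let R : ZFSet.{u} → ZFSet.{u} → Prop := fun a b =>
    b ∈ Y ∧ ∃ c, ZFSet.pair a c ∈ h ∧ ZFSet.pair c b ∈ e
  have hR : ∀ a b b', R a b → R a b' → b = b' := by
    rintro a b b' ⟨-, c, h1, h2⟩ ⟨-, c', h1', h2'⟩
    obtain rfl := hhn.2 _ _ _ h1 h1'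
    exact hcov.1.2 _ _ _ h2 h2'
  let F : ZFSet.{u} → ZFSet.{u} := fun a => if h : ∃ b, R a b then h.choose else x
  have hF : ∀ a b, R a b → F a = b := fun a b hab => by
    have h : ∃ b, R a b := ⟨b, hab⟩
    simp only [F, dif_pos h]
    exact hR _ _ _ h.choose_spec hab
  have hFY : ∀ a, F a ∈ Y := fun a => by
    by_cases h : ∃ b, R a b
    · simp only [F, dif_pos h]
      exact h.choose_spec.1
    · simpa only [F, dif_neg h] using hxY
  obtain ⟨f, hf, hfn, hfd, hfr, hfe⟩ := Submodel.exists_mem (K := HC θ) (M := N')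
    (P := fun f => IsFn f ∧ (∀ a ∈ omegaOne, ∃ b ∈ Y, ZFSet.pair a b ∈ f) ∧
      (∀ q ∈ f, ∃ a ∈ omegaOne, ∃ b ∈ Y, q = ZFSet.pair a b) ∧
      ∀ a ∈ omegaOne, ∀ b ∈ Y, ∀ c ∈ HC θ, ZFSet.pair a c ∈ h → ZFSet.pair c b ∈ e →
        ZFSet.pair a b ∈ f)
    (graph_mem_H p.reg (omegaOne_mem_H p.aleph_one_lt')
      (F := F) fun z _ => H_mono p.lt.le (hYl (hFY z)))
    ⟨isFn_graph _ _, fun a ha => ⟨F a, hFY a, pair_mem_graph.2 ⟨ha, rfl⟩⟩, fun q hq => by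
      obtain ⟨a, ha, rfl⟩ := mem_img.1 hq
      exact ⟨a, ha, F a, hFY a, rfl⟩, fun a ha b hb c _ h1 h2 =>
        pair_mem_graph.2 ⟨ha, hF a b ⟨hb, c, h1, h2⟩⟩⟩
  have hfd' : ∀ a b, ZFSet.pair a b ∈ f → a ∈ omegaOne ∧ b ∈ H l := fun a b hab => by
    obtain ⟨a', ha', b', hb', h⟩ := hfr _ hab
    obtain ⟨rfl, rfl⟩ := ZFSet.pair_inj.1 h
    exact ⟨ha', hYl hb'⟩
  refine ⟨f, isFunc_iff.2 ⟨hfn, fun a ha => (hfd a ha).imp fun _ h => h.2, hfd'⟩,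
    hfe _ (hM.delta_mem p) x hxY _ (toZFSet_mem_H (ha.trans_lt
      (aleph0_lt_aleph_one.trans p.aleph_one_lt'))) hhα hαx,
    parallel_of_mem p hM hN' (hMN.trans hNN') hdN' (p.fn_mem_H hfn hfd') hf⟩

/-! ### Strategies -/

/-- The current model after a finite list of answers of player two. -/
def modelOfList (M : Set ZFSet.{u}) (L : List ZFSet.{u}) : Set ZFSet.{u} := L.foldl hull M

theorem modelOfList_ofFn (M : Set ZFSet.{u}) (f : ℕ → ZFSet.{u}) (n : ℕ) :
    modelOfList M (List.ofFn fun i : Fin n => f i) = model M f n := by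
  induction n with
  | zero => rfl
  | succ n ih =>
    rw [List.ofFn_succ', List.concat_eq_append, modelOfList, List.foldl_append]
    exact congrArg (fun A => hull A (f n)) ih

/-- Player two wins by giving any legal answer: the current model remains a countable elementary
submodel of `H θ` that contains `λ`, so a legal answer always exists. -/
theorem SCCcof.p2HasWinningStrategy (hG : SCCcof θ l) (p : Params θ l) (hM : Good θ l M) :
    P2HasWinningStrategy M (H l) := by
  refine ⟨fun L x => Classical.epsilon (LegalAnswer (H l) (modelOfList M (L.map Prod.snd)) x),
    fun x f hf n hn => ?_⟩
  by_contra! hx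
  have hf' : ∀ k, f k = Classical.epsilon (LegalAnswer (H l) (model M f k) (x k)) := fun k => by
    rw [hf k]
    beta_reduce
    rw [List.map_ofFn]
    exact congrArg (fun A => Classical.epsilon (LegalAnswer (H l) A (x k)))
      (modelOfList_ofFn M f k)
  have key : ∀ k ≤ n, Good θ l (model M f k) → LegalAnswer (H l) (model M f k) (x k) (f k) :=
    fun k hk hgood => by
      rw [hf' k]
      exact Classical.epsilon_spec (hG.exists_legalAnswer p hgood (hx k hk))
  have hgood : ∀ k ≤ n, Good θ l (model M f k) := by
    intro k
    induction k with
    | zero => exact fun _ => hM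
    | succ k ih =>
      intro hk
      have hk' : k ≤ n := (Nat.le_succ k).trans hk
      obtain ⟨hfn, -, hfd⟩ := isFunc_iff.1 (key k hk' (ih hk')).1
      exact ((ih hk').hull p (p.fn_mem_H hfn hfd)).1
  exact hn (key n le_rfl (hgood n le_rfl))

/-- Every sequence of moves of player one extends to a run that follows a given strategy. -/
theorem exists_follows (σ : Strategy.{u}) (x : ℕ → ZFSet.{u}) : ∃ f, Follows σ x f := by
  let hist : ℕ → List (ZFSet.{u} × ZFSet.{u}) := fun n =>
    n.rec [] fun k L => L ++ [(x k, σ L (x k))]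
  refine ⟨fun n => σ (hist n) (x n), fun n => ?_⟩
  suffices h : ∀ n, hist n = List.ofFn fun i : Fin n => (x i, σ (hist i) (x i)) from
    congrArg (fun L => σ L (x n)) (h n)
  intro n
  induction n with
  | zero => rfl
  | succ n ih =>
    rw [List.ofFn_succ', List.concat_eq_append]
    exact congrArg (fun L => L ++ [(x n, σ (hist n) (x n))]) ih

end

end CapturingGame

theorem mainTheorem8 :
    CapturingGame.GlobSCCcof.{u} ↔
      ∀ θ l : Cardinal.{u}, θ.IsRegular → l.IsRegular → Cardinal.aleph 2 ≤ l →
        CapturingGame.MuchSmaller (CapturingGame.cardSet l) θ →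
          ∀ M : Set ZFSet.{u}, CapturingGame.IsCountableSubmodel M θ →
            CapturingGame.cardSet l ∈ M →
              CapturingGame.P2HasWinningStrategy M (CapturingGame.H l) := by
  open CapturingGame in
  constructor
  · intro hG θ l hθ hl h2 hs M hM hlM
    have hG' : SCCcof θ l := fun M hM =>
      hG θ l hθ hl h2 hs M (isCountableSubmodel_iff.2 ⟨hM.countable, hM.sub⟩) hM.mem
    obtain ⟨hc, hsub⟩ := isCountableSubmodel_iff.1 hM
    exact hG'.p2HasWinningStrategy ⟨hθ, hl, h2, hs⟩ ⟨hc, hsub, hlM⟩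
  · intro hW θ l hθ hl h2 hs M hM hlM X hX hXc
    have p : Params θ l := ⟨hθ, hl, h2, hs⟩
    obtain ⟨hc, hsub⟩ := isCountableSubmodel_iff.1 hM
    obtain ⟨σ, hσ⟩ := hW θ l hθ hl h2 hs M hM hlM
    obtain ⟨f, hf⟩ := exists_follows σ fun _ => X
    have hwin := hσ _ f hf 0
    refine exists_parallel_superset p ⟨hc, hsub, hlM⟩ hXc (f := f 0) ?_
    by_contra hleg
    obtain ⟨-, -, hk⟩ := hwin hleg
    exact hk (p.mem_H hX hXc.le)
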